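/- **Setting.** Let $N\ge 1$, let $f_1,\dots,f_N:\mathbb R^n\to\mathbb R$ be differentiable, $f:=\frac1N\sum_{i=1}^N f_i$, let $\varphi:\mathbb R^n\to(-\infty,+\infty]$ be convex, lower semicontinuous and proper, and $\psi:=f+\varphi$. For $\lambda>0$ let $\mathrm{prox}_{\lambda\varphi}(x):=\operatorname{argmin}_y\ \varphi(y)+\frac1{2\lambda}\|x-y\|^2$, and for $v\in\mathbb R^n$ put $F^{\lambda}_v(x):=x-\mathrm{prox}_{\lambda\varphi}(x-\lambda v)$ and $F^I(x):=x-\mathrm{prox}_{\varphi}(x-\nabla f(x))$. For a sample $s=(s_1,\dots,s_b)\in\{1,\dots,N\}^b$ let $\nabla f_s:=\frac1b\sum_{j=1}^b\nabla f_{s_j}$. **Algorithm.** Given are $x^0\in\mathrm{dom}\,\varphi$, integers $K_m,b_m,b_{m,+}\ge1$, parameters $\lambda_k^m,\lambda_+^m>0$ and step sizes $\alpha_k^m,\beta_k^m\ge0$ ($m\ge0$, $0\le k<K_m$). On a probability space the random iterates satisfy $X^0_0=x^0$, $X^{m+1}_0=X^m_{K_m}$ and, with $\tilde X^m:=X^m_0$,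 for $0\le k<K_m$: $$V_k^m=\nabla f_{S_k^m}(X_k^m)-\nabla f_{S_k^m}(\tilde X^m)+\nabla f(\tilde X^m),\qquad Z_k^m=X_k^m+\beta_k^mD_k^m,$$ $$V_{k,+}^m=\nabla f_{S_{k,+}^m}(Z_k^m)-\nabla f_{S_{k,+}^m}(\tilde X^m)+\nabla f(\tilde X^m),\qquad X_{k+1}^m=\mathrm{prox}_{\lambda_+^m\varphi}\bigl(X_k^m+\alpha_k^mD_k^m-\lambda_+^mV_{k,+}^m\bigr),$$ where $D_k^m$ are random directions and $S_k^m$, $S_{k,+}^m$ are random samples of sizes $b_m$, $b_{m,+}$, drawn in the order $S^0_0,S^0_{0,+},S^0_1,S^0_{1,+},\dots,S^0_{K_0-1,+},S^1_0,\dots$. Let $\mathcal F_k^m$ be the $\sigma$-algebra generated by all samples up to and including $S_k^m$, $\mathcal F_{k,+}^m$ the one generated by all samples up to and including $S_{k,+}^m$, and let $\mathcal F_{-1,+}^m$ be generated by all samples drawn before $S_0^m$. Each $S_k^m$ given $\mathcal F_{k-1,+}^m$, and each $S_{k,+}^m$ given $\mathcal F_k^m$, is a random mini-batch: conditionally, its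 entries are either independent and identically distributed (with replacement), or they are distinct and form a uniformly distributed subset of $\{1,\dots,N\}$ of the given size (without replacement). **Assumptions.** (A.1) $\nabla f$ is Lipschitz with modulus $L_f\ge1$. (A.2) $\psi$ is bounded from below on $\mathrm{dom}\,\varphi$. For all $m\ge0$ and $0\le k<K_m$: (C.1) $\nabla f_i$ is $L_i$-Lipschitz for every $i$, and $L:=\max_iL_i$. (C.2) $D_k^m$ is $\mathcal F_k^m$-measurable. (C.3) There is $\nu_k^m>0$ with $\mathbb E[\|D_k^m\|^2\mid\mathcal F_{-1,+}^m]\le(\nu_k^m)^2\,\mathbb E[\|F^{\lambda_k^m}_{V_k^m}(X_k^m)\|^2\mid\mathcal F_{-1,+}^m]$ a.e. (C.4) $\mathbb E[V_k^m\mid\mathcal F_{k-1,+}^m]=\nabla f(X_k^m)$ and $\mathbb E[V_{k,+}^m\mid\mathcal F_k^m]=\nabla f(Z_k^m)$ a.e. **Theorem.** Suppose that for some $\bar\rho\in[0,1)$ and all $m\ge0$, $0\le k<K_m$, $$\lambda_+^m\le\frac1{2L_f+L\tau_m},\qquad \lambda_k^m\le\frac{(1-\bar\rho)\lambda_+^m}{1+(\mu_k^m)^2+(L\beta_k^m\nu_k^m\lambda_+^m)^2K_mb_{m,+}^{-1}},$$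 where $\tau_m:=K_m(b_{m,+}^{-1}+b_m^{-1})^{1/2}$ and $\mu_k^m:=(\alpha_k^m+L_f\beta_k^m\lambda_+^m)\nu_k^m$. Then $(\psi(\tilde X^m))_m$ converges almost surely to a real-valued random variable $Y^*$. If, in addition, there are $\underline\rho,\kappa>0$ such that $$\sum_{m=0}^\infty K_m^2\Bigl[\sum_{k=0}^{K_m-1}\frac1{\lambda_k^m}\Bigr]^{-1}=\infty,\qquad \underline\rho\,\lambda_+^m\le K_m\Bigl[\sum_{k=0}^{K_m-1}\frac1{\lambda_k^m}\Bigr]^{-1},\qquad K_m\lambda_+^m\le\kappa\quad\text{for all }m,$$ then, as $m\to\infty$, $K_m^{-1}\sum_{k=0}^{K_m-1}\|F^I(X_k^m)\|\to0$ almost surely, all $\|F^I(X_k^m)\|$ with $k<K_m$ are integrable, and $K_m^{-1}\sum_{k=0}^{K_m-1}\mathbb E[\|F^I(X_k^m)\|]\to0$. -/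

import Mathlib

open MeasureTheory ProbabilityTheory Filter Topology
open scoped NNReal

noncomputable section

/-- The Euclidean space `ℝⁿ`. -/
abbrev Eucl (n : ℕ) : Type := EuclideanSpace ℝ (Fin n)

/-! ### The composite problem `min ψ = f + φ` -/

/-- The empirical risk `f = (1/N) ∑ᵢ fᵢ`. -/
def avgFun {n N : ℕ} (f : Fin N → Eucl n → ℝ) (x : Eucl n) : ℝ :=
  (N : ℝ)⁻¹ * ∑ i, f i x

/-- The objective `ψ = f + φ`, with values in `(-∞, +∞]`. -/
def psi {n N : ℕ} (f : Fin N → Eucl n → ℝ) (φ : Eucl n → EReal) (x : Eucl n) : EReal :=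
  (avgFun f x : EReal) + φ x

/-- `φ : ℝⁿ → (-∞, +∞]` is convex, lower semicontinuous and proper. -/
structure IsConvexLscProper {n : ℕ} (φ : Eucl n → EReal) : Prop where
  ne_bot : ∀ x, φ x ≠ ⊥
  proper : ∃ x, φ x ≠ ⊤
  lsc : LowerSemicontinuous φ
  convex : ∀ (x y : Eucl n) (a b : ℝ), 0 ≤ a → 0 ≤ b → a + b = 1 →
    φ (a • x + b • y) ≤ (a : EReal) * φ x + (b : EReal) * φ y

/-- `p` minimizes `y ↦ φ y + ½ ‖x - y‖²_Λ`, where `Λ = lam⁻¹ I`. -/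
def IsProxPoint {n : ℕ} (φ : Eucl n → EReal) (lam : ℝ) (x p : Eucl n) : Prop :=
  ∀ y, φ p + ((‖x - p‖ ^ 2 / (2 * lam) : ℝ) : EReal) ≤
    φ y + ((‖x - y‖ ^ 2 / (2 * lam) : ℝ) : EReal)

/-- The proximity operator `prox^Λ_φ (x) = argmin_y φ y + ½ ‖x - y‖²_Λ` with `Λ = lam⁻¹ I`.
For convex, lower semicontinuous, proper `φ` and `lam > 0` the minimizer is unique. -/
def prox {n : ℕ} (φ : Eucl n → EReal) (lam : ℝ) (x : Eucl n) : Eucl n :=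
  Classical.epsilon (IsProxPoint φ lam x)

/-- The residual `F^Λ_v (x) = x - prox^Λ_φ (x - Λ⁻¹ v)` with `Λ = lam⁻¹ I`. -/
def proxResidual {n : ℕ} (φ : Eucl n → EReal) (lam : ℝ) (v x : Eucl n) : Eucl n :=
  x - prox φ lam (x - lam • v)

/-- The exact residual `F^I (x) = x - prox^I_φ (x - ∇f x)`. -/
def exactResidual {n N : ℕ} (f : Fin N → Eucl n → ℝ) (φ : Eucl n → EReal) (x : Eucl n) :
    Eucl n :=
  proxResidual φ 1 (gradient (avgFun f) x) x

/-- The mini-batch gradient `∇f_S (x) = |S|⁻¹ ∑_{i ∈ S} ∇f_i (x)`, for a sample `S` listed as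
`s 0, …, s (b - 1)`. -/
def batchGrad {n N b : ℕ} (f : Fin N → Eucl n → ℝ) (s : Fin b → Fin N) (x : Eucl n) : Eucl n :=
  (b : ℝ)⁻¹ • ∑ j, gradient (f (s j)) x

/-- The variance-reduced oracle `∇f_S (x) - ∇f_S (x̃) + ∇f (x̃)`. -/
def vrOracle {n N b : ℕ} (f : Fin N → Eucl n → ℝ) (s : Fin b → Fin N) (x xt : Eucl n) : Eucl n :=
  batchGrad f s x - batchGrad f s xt + gradient (avgFun f) xt

/-! ### The algorithm -/

/-- Deterministic parameters of the method: initial point, inner-loop lengths `K_m`, batch sizes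
`b_m`, `b_{m,+}`, proximal parameters `λ_k^m`, `λ_+^m`, and step sizes `α_k^m`, `β_k^m`. -/
structure VRParams (n : ℕ) where
  x0 : Eucl n
  K : ℕ → ℕ
  b : ℕ → ℕ
  bPlus : ℕ → ℕ
  lam : ℕ → ℕ → ℝ
  lamPlus : ℕ → ℝ
  alpha : ℕ → ℕ → ℝ
  beta : ℕ → ℕ → ℝ

/-- Admissible parameters: `x⁰ ∈ dom φ`, positive loop lengths, batch sizes and proximal
parameters, nonnegative step sizes. -/
structure VRParams.Admissible {n : ℕ} (P : VRParams n) (φ : Eucl n → EReal) : Prop where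
  x0_mem : φ P.x0 ≠ ⊤
  K_pos : ∀ m, 0 < P.K m
  b_pos : ∀ m, 0 < P.b m
  bPlus_pos : ∀ m, 0 < P.bPlus m
  lam_pos : ∀ m k, k < P.K m → 0 < P.lam m k
  lamPlus_pos : ∀ m, 0 < P.lamPlus m
  alpha_nonneg : ∀ m k, k < P.K m → 0 ≤ P.alpha m k
  beta_nonneg : ∀ m k, k < P.K m → 0 ≤ P.beta m k

/-- The random objects of a run: samples `S_k^m`, `S_{k,+}^m`, directions `D_k^m` and iterates
`X_k^m`. The entries with inner index `k ≥ K_m` (for `X`: `k > K_m`) play no role. -/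
structure VRProcess {n : ℕ} (P : VRParams n) (N : ℕ) (Ω : Type*) where
  S : (m k : ℕ) → Ω → Fin (P.b m) → Fin N
  SPlus : (m k : ℕ) → Ω → Fin (P.bPlus m) → Fin N
  D : (m k : ℕ) → Ω → Eucl n
  X : (m k : ℕ) → Ω → Eucl n

namespace VRProcess

variable {n N : ℕ} {P : VRParams n} {Ω : Type*}

/-- The reference point `X̃^m = X_0^m`. -/
def Xt (R : VRProcess P N Ω) (m : ℕ) (ω : Ω) : Eucl n := R.X m 0 ω

/-- The oracle `V_k^m` at `X_k^m`. -/
def V (R : VRProcess P N Ω) (f : Fin N → Eucl n → ℝ) (m k : ℕ) (ω : Ω) : Eucl n :=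
  vrOracle f (R.S m k ω) (R.X m k ω) (R.Xt m ω)

/-- The trial point `Z_k^m = X_k^m + β_k^m D_k^m`. -/
def Z (R : VRProcess P N Ω) (m k : ℕ) (ω : Ω) : Eucl n :=
  R.X m k ω + P.beta m k • R.D m k ω

/-- The oracle `V_{k,+}^m` at `Z_k^m`. -/
def VPlus (R : VRProcess P N Ω) (f : Fin N → Eucl n → ℝ) (m k : ℕ) (ω : Ω) : Eucl n :=
  vrOracle f (R.SPlus m k ω) (R.Z m k ω) (R.Xt m ω)

/-- The iterates follow the algorithm: start at `x⁰`, each outer loop starts at the last inner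
iterate of the previous one, and
`X_{k+1}^m = prox^{Λ_+}_φ (X_k^m + α_k^m D_k^m - λ_+^m V_{k,+}^m)` with `Λ_+ = (λ_+^m)⁻¹ I`. -/
structure IsGenerated (R : VRProcess P N Ω) (f : Fin N → Eucl n → ℝ) (φ : Eucl n → EReal) :
    Prop where
  init : ∀ ω, R.X 0 0 ω = P.x0
  outer : ∀ m ω, R.X (m + 1) 0 ω = R.X m (P.K m) ω
  inner : ∀ m k, k < P.K m → ∀ ω, R.X m (k + 1) ω =
    prox φ (P.lamPlus m)
      (R.X m k ω + P.alpha m k • R.D m k ω - P.lamPlus m • R.VPlus f m k ω)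

/-- `σ`-algebra of all samples drawn before `S_k^m`. It is `F_{k-1,+}^m`; for `k = 0` it is
`F_{-1,+}^m = F_{K_{m-1}-1,+}^{m-1}`, and it is trivial for `m = k = 0`. -/
@[reducible]
def sigmaBefore (R : VRProcess P N Ω) (m k : ℕ) : MeasurableSpace Ω :=
  ⨆ (i : ℕ) (j : ℕ) (_ : j < P.K i ∧ (i < m ∨ (i = m ∧ j < k))),
    (MeasurableSpace.comap (R.S i j) inferInstance ⊔
      MeasurableSpace.comap (R.SPlus i j) inferInstance)

/-- `F_k^m`: the `σ`-algebra of all samples drawn up to and including `S_k^m`. -/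
@[reducible]
def sigmaUpTo (R : VRProcess P N Ω) (m k : ℕ) : MeasurableSpace Ω :=
  R.sigmaBefore m k ⊔ MeasurableSpace.comap (R.S m k) inferInstance

end VRProcess

/-! ### Random mini-batches -/

/-- Given `𝓖`, the indices `S_0, …, S_{b-1}` are independent and identically distributed
(sampling with replacement). -/
def IsCondIID {Ω : Type*} (𝓖 : MeasurableSpace Ω) [MeasurableSpace Ω] (μ : Measure Ω)
    {N b : ℕ} (S : Ω → Fin b → Fin N) : Prop :=
  (∀ (j j' : Fin b) (i : Fin N), μ⟦{ω | S ω j = i} | 𝓖⟧ =ᵐ[μ] μ⟦{ω | S ω j' = i} | 𝓖⟧) ∧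
  ∀ s : Fin b → Fin N, μ⟦{ω | S ω = s} | 𝓖⟧ =ᵐ[μ]
    fun ω => ∏ j, (μ⟦{ω' | S ω' j = s j} | 𝓖⟧) ω

/-- Given `𝓖`, the set `{S_0, …, S_{b-1}}` is a uniformly distributed `b`-element subset of the
index set (sampling without replacement). -/
def IsCondUniformSubset {Ω : Type*} (𝓖 : MeasurableSpace Ω) [MeasurableSpace Ω] (μ : Measure Ω)
    {N b : ℕ} (S : Ω → Fin b → Fin N) : Prop :=
  (∀ᵐ ω ∂μ, Function.Injective (S ω)) ∧
  ∀ A : Finset (Fin N), A.card = b →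
    μ⟦{ω | Finset.univ.image (S ω) = A} | 𝓖⟧ =ᵐ[μ] fun _ => ((N.choose b : ℕ) : ℝ)⁻¹

/-- A random mini-batch drawn, given `𝓖`, with or without replacement. -/
def IsMiniBatch {Ω : Type*} (𝓖 : MeasurableSpace Ω) [MeasurableSpace Ω] (μ : Measure Ω)
    {N b : ℕ} (S : Ω → Fin b → Fin N) : Prop :=
  IsCondIID 𝓖 μ S ∨ IsCondUniformSubset 𝓖 μ S

/-- All sample sets of the run are random variables and mini-batches given the past. -/
structure VRProcess.HasRandomSamples {n N : ℕ} {P : VRParams n} {Ω : Type*} [MeasurableSpace Ω]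
    (R : VRProcess P N Ω) (μ : Measure Ω) : Prop where
  meas : ∀ m k, k < P.K m → Measurable (R.S m k)
  measPlus : ∀ m k, k < P.K m → Measurable (R.SPlus m k)
  batch : ∀ m k, k < P.K m → IsMiniBatch (R.sigmaBefore m k) μ (R.S m k)
  batchPlus : ∀ m k, k < P.K m → IsMiniBatch (R.sigmaUpTo m k) μ (R.SPlus m k)

/-! ### Assumptions -/

/-- (A.1): `∇f` is Lipschitz with modulus `L_f ≥ 1`. -/
def AssumptionA1 {n N : ℕ} (f : Fin N → Eucl n → ℝ) (Lf : ℝ≥0) : Prop :=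
  1 ≤ Lf ∧ LipschitzWith Lf (gradient (avgFun f))

/-- (A.2): `ψ` is bounded from below on `dom φ`. -/
def AssumptionA2 {n N : ℕ} (f : Fin N → Eucl n → ℝ) (φ : Eucl n → EReal) : Prop :=
  ∃ c : ℝ, ∀ x, φ x ≠ ⊤ → (c : EReal) ≤ psi f φ x

/-- (C.1): each `f_i` is differentiable with `L_i`-Lipschitz gradient. -/
def AssumptionC1 {n N : ℕ} (f : Fin N → Eucl n → ℝ) (Li : Fin N → ℝ≥0) : Prop :=
  ∀ i, Differentiable ℝ (f i) ∧ LipschitzWith (Li i) (gradient (f i))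

/-- (C.2): `D_k^m` is `F_k^m`-measurable. -/
def AssumptionC2 {n N : ℕ} {P : VRParams n} {Ω : Type*} (R : VRProcess P N Ω) : Prop :=
  ∀ m k, k < P.K m → Measurable[R.sigmaUpTo m k] (R.D m k)

/-- (C.3): `ν_k^m > 0` and
`E[‖D_k^m‖² | F_{-1,+}^m] ≤ (ν_k^m)² E[‖F^{Λ_k^m}_{V_k^m} (X_k^m)‖² | F_{-1,+}^m]` a.e. -/
def AssumptionC3 {n N : ℕ} {P : VRParams n} {Ω : Type*} [MeasurableSpace Ω]
    (R : VRProcess P N Ω) (μ : Measure Ω) (f : Fin N → Eucl n → ℝ) (φ : Eucl n → EReal)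
    (nu : ℕ → ℕ → ℝ) : Prop :=
  ∀ m k, k < P.K m → 0 < nu m k ∧
    ∀ᵐ ω ∂μ, (μ[fun ω' => ‖R.D m k ω'‖ ^ 2 | R.sigmaBefore m 0]) ω ≤
      nu m k ^ 2 *
        (μ[fun ω' => ‖proxResidual φ (P.lam m k) (R.V f m k ω') (R.X m k ω')‖ ^ 2 |
          R.sigmaBefore m 0]) ω

/-- (C.4): `E[V_k^m | F_{k-1,+}^m] = ∇f (X_k^m)` and `E[V_{k,+}^m | F_k^m] = ∇f (Z_k^m)` a.e. -/
def AssumptionC4 {n N : ℕ} {P : VRParams n} {Ω : Type*} [MeasurableSpace Ω]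
    (R : VRProcess P N Ω) (μ : Measure Ω) (f : Fin N → Eucl n → ℝ) : Prop :=
  ∀ m k, k < P.K m →
    (μ[R.V f m k | R.sigmaBefore m k] =ᵐ[μ] fun ω => gradient (avgFun f) (R.X m k ω)) ∧
    (μ[R.VPlus f m k | R.sigmaUpTo m k] =ᵐ[μ] fun ω => gradient (avgFun f) (R.Z m k ω))

/-! ### Step size quantities -/

namespace VRParams

variable {n : ℕ}

/-- `τ_m = K_m (1 / b_{m,+} + 1 / b_m)^{1/2}`. -/
def tau (P : VRParams n) (m : ℕ) : ℝ :=
  (P.K m : ℝ) * Real.sqrt ((P.bPlus m : ℝ)⁻¹ + (P.b m : ℝ)⁻¹)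

/-- `μ_k^m = (α_k^m + L_f β_k^m λ_+^m) ν_k^m`. -/
def muCoef (P : VRParams n) (Lf : ℝ) (nu : ℕ → ℕ → ℝ) (m k : ℕ) : ℝ :=
  (P.alpha m k + Lf * P.beta m k * P.lamPlus m) * nu m k

/-- The step size bounds on `λ_+^m` and `λ_k^m`. -/
def StepSizes (P : VRParams n) (Lf L : ℝ) (nu : ℕ → ℕ → ℝ) (rhoBar : ℝ) : Prop :=
  (∀ m, P.lamPlus m ≤ 1 / (2 * Lf + L * P.tau m)) ∧
  ∀ m k, k < P.K m → P.lam m k ≤ (1 - rhoBar) * P.lamPlus m /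
    (1 + P.muCoef Lf nu m k ^ 2 +
      (L * P.beta m k * nu m k * P.lamPlus m) ^ 2 * (P.K m : ℝ) * (P.bPlus m : ℝ)⁻¹)

/-- `∑_{k < K_m} 1 / λ_k^m`. -/
def invLamSum (P : VRParams n) (m : ℕ) : ℝ :=
  ∑ k ∈ Finset.range (P.K m), 1 / P.lam m k

end VRParams

end

/-! The expected objective decreases over every outer loop, and this decrease pays for all error
terms. An inner step is compared with the auxiliary proximal gradient point y = prox_{λφ}(X - λV).
The variational inequalities for X_{k+1} against y and for y against X, added to the quadratic upper
model of f, bound ψ(X_{k+1}) - ψ(X_k) by negative multiples of ‖X_{k+1} - X_k‖² and of the squared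
residual ‖F‖², plus terms in ‖D‖², squared oracle errors, and inner products of those errors with
vectors known before the sample is drawn (`psiReal_step_le`).

Integrated over an event of the history before the outer loop, the inner products vanish by
unbiasedness, ‖D‖² is controlled by (C.3), and the oracle variances are at most L²/b times the
squared distance to the reference point (`IsMiniBatch.condExp_norm_vrOracle_sub_sq_le`). These
distances are sums of earlier increments; over a loop they cost a multiple of L τ_m ∑‖X_{k+1} -
X_k‖², which the bound on λ_+ absorbs. The outcome is `setIntegral_psiReal_outer_le`.

Hence ψ(X̃^m) is a supermartingale bounded below and converges almost surely, and the decreases are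
summable. They dominate the expected `energy`, which is therefore summable in mean and almost
surely. With r_m = ‖F^I(X̃^m)‖ and a_m = K_m² / ∑ 1/λ_k^m, Lipschitz continuity of F^I bounds a_m
r_m², |r_{m+1}² - r_m²| and the squared gap between r_m and the averaged residual by a constant
times the energy (`exists_energy_bounds`). So r_m² converges, and ∑ a_m = ∞ forces the limit 0
(`tendsto_zero_of_summable_weighted`). Run pathwise and on expectations, the argument gives both
modes of convergence.

All random quantities up to a given time are functions of finitely many finite-valued samples, so
measurability and integrability are combinatorial (`FinMeas`). -/

noncomputable section

/-! ### The proximity operator -/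

namespace IsConvexLscProper

variable {n : ℕ} {φ : Eucl n → EReal}

lemma coe_toReal (hφ : IsConvexLscProper φ) {x : Eucl n} (hx : φ x ≠ ⊤) :
    ((φ x).toReal : EReal) = φ x :=
  EReal.coe_toReal hx (hφ.ne_bot x)

lemma comb_le (hφ : IsConvexLscProper φ) {x y : Eucl n} (hx : φ x ≠ ⊤) (hy : φ y ≠ ⊤)
    {a b : ℝ} (ha : 0 ≤ a) (hb : 0 ≤ b) (hab : a + b = 1) :
    φ (a • x + b • y) ≠ ⊤ ∧
      (φ (a • x + b • y)).toReal ≤ a * (φ x).toReal + b * (φ y).toReal := by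
  have h := hφ.convex x y a b ha hb hab
  rw [← hφ.coe_toReal hx, ← hφ.coe_toReal hy, ← EReal.coe_mul, ← EReal.coe_mul,
    ← EReal.coe_add] at h
  have h1 : φ (a • x + b • y) ≠ ⊤ := ne_top_of_le_ne_top (EReal.coe_ne_top _) h
  refine ⟨h1, ?_⟩
  rw [← hφ.coe_toReal h1] at h
  exact_mod_cast h

/-- Lower semicontinuity gives a minimum M over the unit ball around x₀. For y outside the ball,
convexity on the segment from x₀ to y, at its point of distance 1, transfers M to a bound linear in
‖y - x₀‖. This is enough to make the proximal objective coercive. -/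
lemma exists_linear_lower_bound (hφ : IsConvexLscProper φ) {x₀ : Eucl n} (h₀ : φ x₀ ≠ ⊤) :
    ∃ C : ℝ, 0 ≤ C ∧ ∀ y, φ y ≠ ⊤ → -C * (1 + ‖y - x₀‖) ≤ (φ y).toReal := by
  obtain ⟨z, -, hz⟩ := LowerSemicontinuousOn.exists_isMinOn
    (⟨x₀, Metric.mem_closedBall_self zero_le_one⟩ : (Metric.closedBall x₀ 1).Nonempty)
    (isCompact_closedBall x₀ 1) (hφ.lsc.lowerSemicontinuousOn _)
  have hz₀ : φ z ≠ ⊤ :=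
    ne_top_of_le_ne_top h₀ (hz (Metric.mem_closedBall_self zero_le_one))
  have hmin : ∀ w, ‖w - x₀‖ ≤ 1 → φ w ≠ ⊤ → (φ z).toReal ≤ (φ w).toReal := by
    intro w hw hw'
    have : φ z ≤ φ w := hz (by simpa [dist_eq_norm] using hw)
    exact EReal.toReal_le_toReal this (hφ.ne_bot z) hw'
  set M := (φ z).toReal
  set c := (φ x₀).toReal
  refine ⟨|M| + |c|, by positivity, fun y hy => ?_⟩
  set r := ‖y - x₀‖ with hr
  have hr0 : 0 ≤ r := norm_nonneg _
  have hM := neg_abs_le M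
  have hc := le_abs_self c
  have hM' := abs_nonneg M
  have hc' := abs_nonneg c
  rcases le_or_gt r 1 with h | h
  · have := hmin y h hy
    nlinarith
  · have hr1 : 0 < r := by linarith
    have hs1 : r⁻¹ ≤ 1 := inv_le_one_of_one_le₀ h.le
    obtain ⟨h1, h2⟩ := hφ.comb_le h₀ hy (a := 1 - r⁻¹) (b := r⁻¹) (by linarith)
      (by positivity) (by ring)
    have h3 := hmin _ (by
      have : (1 - r⁻¹) • x₀ + r⁻¹ • y - x₀ = r⁻¹ • (y - x₀) := by module
      rw [this, norm_smul, ← hr, Real.norm_of_nonneg (by positivity),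
        inv_mul_cancel₀ hr1.ne']) h1
    have h4 : r * M ≤ (r - 1) * c + (φ y).toReal := by
      have := mul_le_mul_of_nonneg_left (h3.trans h2) hr0
      have e : r * ((1 - r⁻¹) * c + r⁻¹ * (φ y).toReal) = (r - 1) * c + (φ y).toReal := by
        field_simp
      linarith
    nlinarith

lemma exists_isProxPoint (hφ : IsConvexLscProper φ) {lam : ℝ} (hlam : 0 < lam) (u : Eucl n) :
    ∃ p, IsProxPoint φ lam u p := by
  obtain ⟨x₀, h₀⟩ := hφ.proper
  obtain ⟨C, hC, hlow⟩ := hφ.exists_linear_lower_bound h₀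
  set c := (φ x₀).toReal
  set d := ‖u - x₀‖
  have hd : 0 ≤ d := norm_nonneg _
  -- For r ≥ 1 one has C(1 + r) + |c| ≤ (2C + |c|) r, so (r - d)² ≥ d² + 2 lam (C(1 + r) + |c|)
  -- holds once r ≥ 2d + 2 lam (2C + |c|). Beyond radius R, no point beats x₀. The final 1 ensures r
  -- ≥ 1.
  set R := 2 * d + 2 * lam * (2 * C + |c|) + 1
  have hR : 1 ≤ R := by
    have : 0 ≤ 2 * lam * (2 * C + |c|) := by positivity
    simp only [R]; linarith
  have hx₀ : x₀ ∈ Metric.closedBall x₀ R := Metric.mem_closedBall_self (by linarith)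
  have hlsc : LowerSemicontinuous
      (fun y => φ y + ((‖u - y‖ ^ 2 / (2 * lam) : ℝ) : EReal)) := by
    refine hφ.lsc.add' (Continuous.lowerSemicontinuous ?_) fun x =>
      EReal.continuousAt_add (Or.inr (EReal.coe_ne_bot _)) (Or.inr (EReal.coe_ne_top _))
    exact continuous_coe_real_ereal.comp (by fun_prop)
  obtain ⟨p, -, hp⟩ := LowerSemicontinuousOn.exists_isMinOn ⟨x₀, hx₀⟩
    (isCompact_closedBall x₀ R) (hlsc.lowerSemicontinuousOn _)
  refine ⟨p, fun y => ?_⟩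
  by_cases hy : y ∈ Metric.closedBall x₀ R
  · exact hp hy
  by_cases hyt : φ y = ⊤
  · rw [hyt, EReal.top_add_of_ne_bot (EReal.coe_ne_bot _)]
    exact le_top
  refine (hp hx₀).trans ?_
  change φ x₀ + ((‖u - x₀‖ ^ 2 / (2 * lam) : ℝ) : EReal) ≤ _
  rw [← hφ.coe_toReal h₀, ← hφ.coe_toReal hyt]
  norm_cast
  set r := ‖y - x₀‖
  have hr : R < r := by simpa [dist_eq_norm] using hy
  have h1 := hlow y hyt
  have h2 : r - d ≤ ‖u - y‖ := by
    have := norm_sub_norm_le (y - x₀) (u - x₀)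
    rwa [sub_sub_sub_cancel_right, norm_sub_rev y u] at this
  have hRd : d ≤ R := by
    have : 0 ≤ 2 * lam * (2 * C + |c|) := by positivity
    simp only [R]; linarith
  have h3 : (r - d) ^ 2 ≤ ‖u - y‖ ^ 2 := pow_le_pow_left₀ (by linarith) h2 2
  have h4 : d ^ 2 / (2 * lam) + (C * (1 + r) + |c|) ≤ (r - d) ^ 2 / (2 * lam) := by
    rw [div_add' _ _ _ (by positivity), div_le_div_iff_of_pos_right (by positivity)]
    have h5 : 0 ≤ 2 * lam * |c| * (r - 1) := by
      have : 0 ≤ r - 1 := by linarith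
      positivity
    have h6 : 0 ≤ 2 * lam * C * (r - 1) := by
      have : 0 ≤ r - 1 := by linarith
      positivity
    have h7 : 0 ≤ r * (r - R) := mul_nonneg (by linarith) (by linarith)
    simp only [R] at h7
    nlinarith
  have h8 : ‖u - x₀‖ = d := rfl
  have h9 : (r - d) ^ 2 / (2 * lam) ≤ ‖u - y‖ ^ 2 / (2 * lam) := by gcongr
  have := le_abs_self c
  change c + d ^ 2 / (2 * lam) ≤ _
  linarith

lemma isProxPoint_prox (hφ : IsConvexLscProper φ) {lam : ℝ} (hlam : 0 < lam) (u : Eucl n) :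
    IsProxPoint φ lam u (prox φ lam u) :=
  Classical.epsilon_spec (hφ.exists_isProxPoint hlam u)

lemma prox_ne_top (hφ : IsConvexLscProper φ) {lam : ℝ} (hlam : 0 < lam) (u : Eucl n) :
    φ (prox φ lam u) ≠ ⊤ := by
  obtain ⟨x₀, h₀⟩ := hφ.proper
  intro h
  have := hφ.isProxPoint_prox hlam u x₀
  rw [h, EReal.top_add_of_ne_bot (EReal.coe_ne_bot _), ← hφ.coe_toReal h₀] at this
  exact EReal.coe_ne_top _ (top_le_iff.mp this)

/-- The variational inequality characterizing the proximity operator. -/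
lemma prox_le (hφ : IsConvexLscProper φ) {lam : ℝ} (hlam : 0 < lam) (u : Eucl n) {w : Eucl n}
    (hw : φ w ≠ ⊤) :
    (φ (prox φ lam u)).toReal ≤ (φ w).toReal +
      lam⁻¹ * inner ℝ (u - prox φ lam u) (prox φ lam u - w) := by
  set p := prox φ lam u with hp
  have hpt : φ p ≠ ⊤ := hφ.prox_ne_top hlam u
  set D := ‖w - p‖ ^ 2 / (2 * lam) with hD
  set G := inner ℝ (u - p) (p - w) with hG
  -- Minimality of p against the segment point p + t(w - p), combined with convexity and divided by
  -- t. The error t * D disappears as t → 0.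
  have key : ∀ t : ℝ, 0 < t → t ≤ 1 →
      (φ p).toReal ≤ (φ w).toReal + lam⁻¹ * G + t * D := by
    intro t ht ht1
    obtain ⟨h1, h2⟩ := hφ.comb_le hpt hw (a := 1 - t) (b := t) (by linarith) ht.le (by ring)
    have h3 := hφ.isProxPoint_prox hlam u ((1 - t) • p + t • w)
    rw [← hp, ← hφ.coe_toReal hpt, ← hφ.coe_toReal h1] at h3
    norm_cast at h3
    have h4 : ‖u - ((1 - t) • p + t • w)‖ ^ 2
        = ‖u - p‖ ^ 2 + 2 * t * G + t ^ 2 * ‖w - p‖ ^ 2 := by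
      have e : u - ((1 - t) • p + t • w) = (u - p) + t • (p - w) := by module
      rw [e, norm_add_sq_real, inner_smul_right, norm_smul, Real.norm_of_nonneg ht.le,
        norm_sub_rev p w]
      ring
    have h5 : t * (φ p).toReal ≤ t * ((φ w).toReal + lam⁻¹ * G + t * D) := by
      rw [h4] at h3
      have e : (‖u - p‖ ^ 2 + 2 * t * G + t ^ 2 * ‖w - p‖ ^ 2) / (2 * lam)
          = ‖u - p‖ ^ 2 / (2 * lam) + t * (lam⁻¹ * G) + t * (t * D) := by
        rw [hD]; field_simp
      rw [e] at h3
      linarith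
    exact le_of_mul_le_mul_left h5 ht
  have hD0 : 0 ≤ D := by positivity
  refine le_of_forall_pos_le_add fun ε hε => ?_
  have ht : 0 < min 1 (ε / (D + 1)) := lt_min one_pos (by positivity)
  have := key _ ht (min_le_left _ _)
  have h6 : min 1 (ε / (D + 1)) * D ≤ ε := by
    have h7 : min 1 (ε / (D + 1)) * D ≤ ε / (D + 1) * D :=
      mul_le_mul_of_nonneg_right (min_le_right _ _) hD0
    have h8 : ε / (D + 1) * D ≤ ε := by
      rw [div_mul_eq_mul_div, div_le_iff₀ (by positivity)]
      nlinarith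
    linarith
  linarith

/-- The variational inequalities at p and q, each tested with the other point, add up to ‖p - q‖² ≤
⟨u - v, p - q⟩. -/
lemma norm_prox_sub_prox_le (hφ : IsConvexLscProper φ) {lam : ℝ} (hlam : 0 < lam)
    (u v : Eucl n) : ‖prox φ lam u - prox φ lam v‖ ≤ ‖u - v‖ := by
  have h1 := hφ.prox_le hlam u (hφ.prox_ne_top hlam v)
  have h2 := hφ.prox_le hlam v (hφ.prox_ne_top hlam u)
  set p := prox φ lam u
  set q := prox φ lam v
  have h3 : 0 ≤ lam⁻¹ * (inner ℝ (u - p) (p - q) + inner ℝ (v - q) (q - p)) := by linarith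
  have h4 : 0 ≤ inner ℝ (u - p) (p - q) + inner ℝ (v - q) (q - p) :=
    nonneg_of_mul_nonneg_right h3 (by positivity)
  have h5 : inner ℝ (u - p) (p - q) + inner ℝ (v - q) (q - p)
      = inner ℝ (u - v) (p - q) - ‖p - q‖ ^ 2 := by
    rw [← real_inner_self_eq_norm_sq, ← neg_sub p q, inner_neg_right, ← sub_eq_add_neg,
      ← inner_sub_left, ← inner_sub_left]
    congr 1; abel
  have h6 := real_inner_le_norm (u - v) (p - q)
  by_contra! h
  nlinarith [norm_nonneg (u - v)]

lemma norm_proxResidual_sub_le (hφ : IsConvexLscProper φ) {lam : ℝ} (hlam : 0 < lam)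
    (v w x : Eucl n) :
    ‖proxResidual φ lam v x - proxResidual φ lam w x‖ ≤ lam * ‖v - w‖ := by
  unfold proxResidual
  have := hφ.norm_prox_sub_prox_le hlam (x - lam • w) (x - lam • v)
  rw [sub_sub_sub_cancel_left] at this ⊢
  rwa [← smul_sub, norm_smul, Real.norm_of_nonneg hlam.le] at this

/-- For `lam ≤ 1`, the residual with parameter `1` is at most `lam⁻¹` times the residual with
parameter `lam`. -/
lemma mul_norm_proxResidual_one_le (hφ : IsConvexLscProper φ) {lam : ℝ} (hlam : 0 < lam)
    (hlam1 : lam ≤ 1) (g x : Eucl n) :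
    lam * ‖proxResidual φ 1 g x‖ ≤ ‖proxResidual φ lam g x‖ := by
  have h1 := hφ.prox_le hlam (x - lam • g) (hφ.prox_ne_top one_pos (x - (1 : ℝ) • g))
  have h2 := hφ.prox_le one_pos (x - (1 : ℝ) • g) (hφ.prox_ne_top hlam (x - lam • g))
  unfold proxResidual
  set p := prox φ lam (x - lam • g)
  set q := prox φ 1 (x - (1 : ℝ) • g)
  set A := x - p with hA
  set B := x - q with hB
  have e1 : x - lam • g - p = A - lam • g := by rw [hA]; abel
  have e2 : x - (1 : ℝ) • g - q = B - g := by rw [hB]; module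
  have e3 : p - q = B - A := by rw [hA, hB]; abel
  have e4 : q - p = -(B - A) := by rw [hA, hB]; abel
  rw [e1, e3, inner_sub_left, inner_smul_left] at h1
  rw [e2, e4, inner_neg_right, inner_sub_left] at h2
  have h3 : lam⁻¹ * (inner ℝ A (B - A) - lam * inner ℝ g (B - A))
      = lam⁻¹ * inner ℝ A (B - A) - inner ℝ g (B - A) := by field_simp
  simp only [RCLike.conj_to_real] at h1
  rw [h3] at h1
  have h4 : 0 ≤ lam⁻¹ * inner ℝ A (B - A) - inner ℝ B (B - A) := by linarith
  have h5 : 0 ≤ inner ℝ A (B - A) - lam * inner ℝ B (B - A) := by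
    have := mul_nonneg hlam.le h4
    rwa [mul_sub, mul_inv_cancel_left₀ hlam.ne'] at this
  rw [inner_sub_right A B A, inner_sub_right B B A, real_inner_self_eq_norm_sq,
    real_inner_self_eq_norm_sq, real_inner_comm] at h5
  have h6 := real_inner_le_norm B A
  -- The product is nonpositive, so ‖A‖ lies between lam ‖B‖ and ‖B‖; only the lower end is needed.
  have h7 : (lam * ‖B‖ - ‖A‖) * (‖B‖ - ‖A‖) ≤ 0 := by nlinarith
  by_contra! h
  have : ‖A‖ < ‖B‖ := by nlinarith [norm_nonneg B]
  nlinarith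

end IsConvexLscProper

/-- A function with `L`-Lipschitz gradient lies below its quadratic upper model. -/
lemma le_quadratic_of_lipschitzWith_gradient {n : ℕ} {g : Eucl n → ℝ} {K : ℝ≥0}
    (hg : Differentiable ℝ g) (hK : LipschitzWith K (gradient g)) (x y : Eucl n) :
    g y ≤ g x + inner ℝ (gradient g x) (y - x) + K / 2 * ‖y - x‖ ^ 2 := by
  set h : ℝ → ℝ := fun t => g (x + t • (y - x)) with hh
  set B : ℝ → ℝ := fun t => g x + t * inner ℝ (gradient g x) (y - x)
    + K / 2 * ‖y - x‖ ^ 2 * t ^ 2 with hB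
  have hd : ∀ t, HasDerivAt h (inner ℝ (gradient g (x + t • (y - x))) (y - x)) t := by
    intro t
    have h1 := (hg (x + t • (y - x))).hasGradientAt.hasFDerivAt
    have h2 : HasDerivAt (fun t : ℝ => x + t • (y - x)) (y - x) t := by
      simpa using ((hasDerivAt_id t).smul_const (y - x)).const_add x
    have h3 := h1.comp_hasDerivAt t h2
    rwa [InnerProductSpace.toDual_apply_apply] at h3
  have hBd : ∀ t, HasDerivAt B (inner ℝ (gradient g x) (y - x)
      + K / 2 * ‖y - x‖ ^ 2 * (2 * t)) t := by
    intro t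
    have h1 := ((hasDerivAt_id t).mul_const (inner ℝ (gradient g x) (y - x))).const_add (g x)
    have h2 := ((hasDerivAt_id t).pow 2).const_mul (K / 2 * ‖y - x‖ ^ 2)
    exact (h1.add h2).congr_deriv (by simp)
  have := image_le_of_deriv_right_le_deriv_boundary (f := h) (a := 0) (b := 1) (B := B)
    (fun t _ => (hd t).continuousAt.continuousWithinAt) (fun t _ => (hd t).hasDerivWithinAt)
    (by simp [hh, hB]) (fun t _ => (hBd t).continuousAt.continuousWithinAt)
    (fun t _ => (hBd t).hasDerivWithinAt) (fun t ht => by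
      have h1 := real_inner_le_norm (gradient g (x + t • (y - x)) - gradient g x) (y - x)
      have h2 := hK.norm_sub_le (x + t • (y - x)) x
      rw [add_sub_cancel_left, norm_smul, Real.norm_of_nonneg ht.1] at h2
      rw [inner_sub_left] at h1
      have h3 := mul_le_mul_of_nonneg_right h2 (norm_nonneg (y - x))
      nlinarith) (x := 1) (by simp)
  simpa [hh, hB] using this

/-! ### Finite sampling identities -/

section FiniteSampling

variable {ι E : Type*} [Fintype ι] [NormedAddCommGroup E] [InnerProductSpace ℝ E]

lemma sum_mul_norm_sub_sq_le {p : ι → ℝ} (hp : ∑ i, p i = 1) {a : ι → E} {c : E}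
    (hc : ∑ i, p i • a i = c) : ∑ i, p i * ‖a i - c‖ ^ 2 ≤ ∑ i, p i * ‖a i‖ ^ 2 := by
  have h : ∑ i, p i * ‖a i - c‖ ^ 2
      = ∑ i, p i * ‖a i‖ ^ 2 - 2 * inner ℝ (∑ i, p i • a i) c + (∑ i, p i) * ‖c‖ ^ 2 := by
    rw [sum_inner, Finset.mul_sum, Finset.sum_mul, ← Finset.sum_sub_distrib,
      ← Finset.sum_add_distrib]
    refine Finset.sum_congr rfl fun i _ => ?_
    rw [norm_sub_sq_real, real_inner_smul_left]
    ring
  rw [h, hc, hp, real_inner_self_eq_norm_sq]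
  nlinarith [sq_nonneg ‖c‖]

lemma sum_prod_eq_one {p : ι → ℝ} (hp : ∑ i, p i = 1) (b : ℕ) :
    ∑ s : Fin b → ι, ∏ j, p (s j) = 1 := by
  rw [← Fintype.sum_pow, hp, one_pow]

lemma sum_fin_succ_fun {M : Type*} [AddCommMonoid M] {b : ℕ} (G : (Fin (b + 1) → ι) → M) :
    ∑ s, G s = ∑ i, ∑ s : Fin b → ι, G (Fin.cons i s) := by
  rw [← (Fin.consEquiv fun _ => ι).sum_comp, Fintype.sum_prod_type]
  rfl

/-- The mean of a sum of `b` independent vectors with law `p`. -/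
lemma sum_prod_smul_sum {p : ι → ℝ} (hp : ∑ i, p i = 1) (y : ι → E) (b : ℕ) :
    ∑ s : Fin b → ι, (∏ j, p (s j)) • ∑ j, y (s j) = (b : ℝ) • ∑ i, p i • y i := by
  induction b with
  | zero => simp
  | succ b ih =>
    have h : ∀ i (s : Fin b → ι), (p i * ∏ j, p (s j)) • (y i + ∑ j, y (s j))
        = (∏ j, p (s j)) • (p i • y i) + p i • ((∏ j, p (s j)) • ∑ j, y (s j)) := by
      intro i s
      module
    rw [sum_fin_succ_fun]
    simp only [Fin.prod_univ_succ, Fin.sum_univ_succ, Fin.cons_zero, Fin.cons_succ, h,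
      Finset.sum_add_distrib, ← Finset.sum_smul, ← Finset.smul_sum, sum_prod_eq_one hp, ih, hp]
    push_cast
    module

/-- The second moment of a sum of `b` independent centered vectors with law `p`. -/
lemma sum_prod_mul_norm_sum_sq {p : ι → ℝ} (hp : ∑ i, p i = 1) {y : ι → E}
    (hy : ∑ i, p i • y i = 0) (b : ℕ) :
    ∑ s : Fin b → ι, (∏ j, p (s j)) * ‖∑ j, y (s j)‖ ^ 2 = b * ∑ i, p i * ‖y i‖ ^ 2 := by
  induction b with
  | zero => simp
  | succ b ih =>
    have h : ∀ i (s : Fin b → ι), (p i * ∏ j, p (s j)) * ‖y i + ∑ j, y (s j)‖ ^ 2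
        = (∏ j, p (s j)) * (p i * ‖y i‖ ^ 2)
          + 2 * inner ℝ (p i • y i) ((∏ j, p (s j)) • ∑ j, y (s j))
          + p i * ((∏ j, p (s j)) * ‖∑ j, y (s j)‖ ^ 2) := by
      intro i s
      rw [norm_add_sq_real, real_inner_smul_left, real_inner_smul_right]
      ring
    rw [sum_fin_succ_fun]
    simp only [Fin.prod_univ_succ, Fin.sum_univ_succ, Fin.cons_zero, Fin.cons_succ, h,
      Finset.sum_add_distrib, ← Finset.sum_mul, ← Finset.mul_sum, ← inner_sum, ← sum_inner,
      sum_prod_eq_one hp, ih, hp, hy, inner_zero_left]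
    push_cast
    ring

/-- The second moment of the sum over a uniformly distributed `b`-element subset of centered
vectors, up to normalization. -/
lemma sum_powersetCard_norm_sum_sq_le [DecidableEq ι] {y : ι → E} (hy : ∑ i, y i = 0) (b : ℕ) :
    (Fintype.card ι : ℝ) * ∑ A ∈ Finset.univ.powersetCard b, ‖∑ i ∈ A, y i‖ ^ 2
      ≤ b * (Fintype.card ι).choose b * ∑ i, ‖y i‖ ^ 2 := by
  rcases Nat.eq_zero_or_pos b with rfl | hb
  · simp
  set Q := (Finset.univ : Finset ι).powersetCard b
  have hcard : ∀ i, ((Q.filter (i ∈ ·)).card : ℝ)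
      = (Fintype.card ι - 1).choose (b - 1) := by
    intro i
    have := Finset.card_filter_powersetCard_subset {i} Finset.univ b (Finset.subset_univ _)
      (by simpa using Nat.one_le_iff_ne_zero.mpr hb.ne')
    simpa [Q] using this
  -- All pairs of distinct indices lie in equally many subsets; for b = 1 there are none, and the
  -- truncated b - 2 must be avoided.
  obtain ⟨c, hc0, hc⟩ : ∃ c : ℝ, 0 ≤ c ∧
      ∀ i j, i ≠ j → ((Q.filter (fun A => i ∈ A ∧ j ∈ A)).card : ℝ) = c := by
    rcases le_or_gt 2 b with hb2 | hb2
    · refine ⟨((Fintype.card ι - 2).choose (b - 2) : ℕ), by positivity, fun i j hij => ?_⟩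
      have := Finset.card_filter_powersetCard_subset {i, j} Finset.univ b
        (Finset.subset_univ _) (by rwa [Finset.card_pair hij])
      simpa [Q, Finset.card_pair hij, Finset.insert_subset_iff] using this
    · refine ⟨0, le_rfl, fun i j hij => ?_⟩
      rw [Nat.cast_eq_zero, Finset.card_eq_zero, Finset.filter_eq_empty_iff]
      rintro A hA ⟨hi, hj⟩
      have := Finset.one_lt_card.mpr ⟨i, hi, j, hj, hij⟩
      rw [(Finset.mem_powersetCard.mp hA).2] at this
      omega
  set C : ℝ := (((Fintype.card ι - 1).choose (b - 1) : ℕ) : ℝ)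
  have hsum : ∑ A ∈ Q, ‖∑ i ∈ A, y i‖ ^ 2
      = ∑ i, ∑ j, ((Q.filter (fun A => i ∈ A ∧ j ∈ A)).card : ℝ) * inner ℝ (y i) (y j) := by
    have h1 : ∀ A : Finset ι, ‖∑ i ∈ A, y i‖ ^ 2
        = ∑ i, ∑ j, (if i ∈ A ∧ j ∈ A then inner ℝ (y i) (y j) else 0) := by
      intro A
      have e : ∀ g : ι → ℝ, ∑ i ∈ A, g i = ∑ i, if i ∈ A then g i else 0 := fun g => by simp
      rw [← real_inner_self_eq_norm_sq, sum_inner, e]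
      refine Finset.sum_congr rfl fun i _ => ?_
      rw [inner_sum, e]
      split_ifs with h <;> simp [h]
    simp_rw [h1]
    rw [Finset.sum_comm]
    refine Finset.sum_congr rfl fun i _ => ?_
    rw [Finset.sum_comm]
    refine Finset.sum_congr rfl fun j _ => ?_
    rw [← Finset.sum_filter, Finset.sum_const, nsmul_eq_mul]
  have h2 : ∀ i j, ((Q.filter (fun A => i ∈ A ∧ j ∈ A)).card : ℝ) * inner ℝ (y i) (y j)
      = c * inner ℝ (y i) (y j) + if i = j then (C - c) * ‖y i‖ ^ 2 else 0 := by
    intro i j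
    split_ifs with h
    · subst h
      simp only [and_self, hcard, real_inner_self_eq_norm_sq]
      ring
    · rw [hc i j h, add_zero]
  -- Giving every pair the weight c contributes c ‖∑ y‖² = 0, so only the diagonal surplus C - c
  -- survives. Since c ≥ 0, sampling without replacement obeys the same bound as independent
  -- sampling.
  have h3 : ∑ A ∈ Q, ‖∑ i ∈ A, y i‖ ^ 2 = (C - c) * ∑ i, ‖y i‖ ^ 2 := by
    rw [hsum]
    simp_rw [h2, Finset.sum_add_distrib, ← Finset.mul_sum, ← inner_sum, ← sum_inner, hy]
    simp [Finset.mul_sum]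
  rw [h3]
  have hY : 0 ≤ ∑ i, ‖y i‖ ^ 2 := by positivity
  have h4 : (Fintype.card ι : ℝ) * C = b * (Fintype.card ι).choose b := by
    simp only [C]
    rcases Nat.eq_zero_or_pos (Fintype.card ι) with h0 | hpos
    · rw [h0, Nat.choose_eq_zero_of_lt hb]; simp
    · have := Nat.add_one_mul_choose_eq (Fintype.card ι - 1) (b - 1)
      rw [Nat.sub_add_cancel hpos, Nat.sub_add_cancel hb] at this
      rw [mul_comm (b : ℝ)]
      exact_mod_cast this
  rw [← h4, mul_assoc]
  gcongr
  linarith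

end FiniteSampling

/-! ### Measurable functions with finite range -/

/-- `g` takes finitely many values and all its fibres are `𝓖`-measurable. -/
def FinMeas {Ω E : Type*} (𝓖 : MeasurableSpace Ω) (g : Ω → E) : Prop :=
  (Set.range g).Finite ∧ ∀ s, MeasurableSet[𝓖] (g ⁻¹' s)

namespace FinMeas

variable {Ω E E' E'' : Type*} {𝓖 𝓗 : MeasurableSpace Ω}

lemma const (c : E) : FinMeas 𝓖 (fun _ : Ω => c) :=
  ⟨(Set.finite_singleton c).subset (by rintro _ ⟨_, rfl⟩; rfl), fun s => by
    by_cases h : c ∈ s <;> simp [h]⟩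

lemma mono {g : Ω → E} (hg : FinMeas 𝓖 g) (h : 𝓖 ≤ 𝓗) : FinMeas 𝓗 g :=
  ⟨hg.1, fun s => h _ (hg.2 s)⟩

/-- `FinMeas` asks for preimages of arbitrary sets, so h needs no regularity. Measurability of
`prox`, `gradient` or φ is therefore never an issue. -/
lemma comp {g : Ω → E} (hg : FinMeas 𝓖 g) (h : E → E') : FinMeas 𝓖 (fun ω => h (g ω)) :=
  ⟨(hg.1.image h).subset (by rintro _ ⟨ω, rfl⟩; exact ⟨_, ⟨ω, rfl⟩, rfl⟩), fun s => hg.2 (h ⁻¹' s)⟩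

lemma prodMk {g : Ω → E} {g' : Ω → E'} (hg : FinMeas 𝓖 g) (hg' : FinMeas 𝓖 g') :
    FinMeas 𝓖 (fun ω => (g ω, g' ω)) := by
  have hfin : (Set.range fun ω => (g ω, g' ω)).Finite :=
    (hg.1.prod hg'.1).subset (by rintro _ ⟨ω, rfl⟩; exact ⟨⟨ω, rfl⟩, ⟨ω, rfl⟩⟩)
  refine ⟨hfin, fun s => ?_⟩
  have : (fun ω => (g ω, g' ω)) ⁻¹' s
      = ⋃ y ∈ s ∩ Set.range (fun ω => (g ω, g' ω)), g ⁻¹' {y.1} ∩ g' ⁻¹' {y.2} := by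
    ext ω
    simp only [Set.mem_preimage, Set.mem_iUnion, Set.mem_inter_iff, Set.mem_singleton_iff,
      Set.mem_range, exists_prop, Prod.exists, Prod.mk.injEq]
    constructor
    · exact fun h => ⟨_, _, ⟨h, ω, rfl, rfl⟩, rfl, rfl⟩
    · rintro ⟨a, b, ⟨h, -⟩, rfl, rfl⟩
      exact h
  rw [this]
  exact MeasurableSet.biUnion (hfin.inter_of_right s).countable fun y _ =>
    (hg.2 _).inter (hg'.2 _)

lemma map₂ {g : Ω → E} {g' : Ω → E'} (hg : FinMeas 𝓖 g) (hg' : FinMeas 𝓖 g')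
    (h : E → E' → E'') : FinMeas 𝓖 (fun ω => h (g ω) (g' ω)) :=
  (hg.prodMk hg').comp fun p => h p.1 p.2

lemma stronglyMeasurable [TopologicalSpace E] {g : Ω → E} (hg : FinMeas 𝓖 g) :
    StronglyMeasurable[𝓖] g :=
  @SimpleFunc.stronglyMeasurable _ _ 𝓖 _
    (@SimpleFunc.mk _ 𝓖 _ g (fun y => hg.2 {y}) hg.1)

lemma integrable [MeasurableSpace Ω] {μ : Measure Ω} [IsFiniteMeasure μ] [NormedAddCommGroup E]
    {g : Ω → E} (hle : 𝓖 ≤ ‹MeasurableSpace Ω›) (hg : FinMeas 𝓖 g) : Integrable g μ :=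
  SimpleFunc.integrable_of_isFiniteMeasure
    (SimpleFunc.mk g (fun y => hle _ (hg.2 {y})) hg.1)

/-- A function that is measurable for a finitely generated `σ`-algebra is finite-valued. -/
lemma of_measurable {τ : Type*} [Finite τ] {T : Ω → τ} (hT : 𝓖 ≤ MeasurableSpace.comap T ⊤)
    [MeasurableSpace E] [MeasurableSingletonClass E] {g : Ω → E} (hg : Measurable[𝓖] g) :
    FinMeas 𝓖 g := by
  -- The fibre of g through ω is a T-preimage, so g is constant wherever T is; finiteness of the
  -- target of T then bounds the range of g.
  have hfac : Function.FactorsThrough g T := by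
    intro ω ω' h
    obtain ⟨s, -, hs⟩ := hT _ (hg (measurableSet_singleton (g ω)))
    have h1 : ω ∈ T ⁻¹' s := by rw [hs]; rfl
    have h2 : ω' ∈ T ⁻¹' s := by
      rw [Set.mem_preimage] at h1 ⊢
      rwa [← h]
    rw [hs] at h2
    exact h2.symm
  have hfin : (Set.range g).Finite := by
    rcases isEmpty_or_nonempty Ω with h | ⟨⟨ω₀⟩⟩
    · rw [Set.range_eq_empty]; exact Set.finite_empty
    · refine (Set.finite_range (Function.extend T g fun _ => g ω₀)).subset ?_
      rintro _ ⟨ω, rfl⟩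
      exact ⟨T ω, hfac.extend_apply _ ω⟩
  refine ⟨hfin, fun s => ?_⟩
  have : g ⁻¹' s = g ⁻¹' (s ∩ Set.range g) := by
    ext ω; simp
  rw [this]
  exact hg (hfin.inter_of_right s).measurableSet

end FinMeas

/-! ### Conditional moments of mini-batch oracles -/

section CondMoments

variable {Ω : Type*} {𝓖 : MeasurableSpace Ω} [mΩ : MeasurableSpace Ω] {μ : Measure Ω}
  [IsProbabilityMeasure μ]

/-- Conditional expectation of a function of a finite-valued variable and of the past. -/
lemma condExp_apply_fintype {τ E : Type*} [Fintype τ] [NormedAddCommGroup E] [NormedSpace ℝ E]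
    [CompleteSpace E] (hle : 𝓖 ≤ mΩ) {T : Ω → τ} (hT : ∀ t, MeasurableSet {ω | T ω = t})
    {H : τ → Ω → E} (hH : ∀ t, FinMeas 𝓖 (H t)) :
    μ[fun ω => H (T ω) ω | 𝓖] =ᵐ[μ] fun ω => ∑ t, (μ⟦{ω' | T ω' = t} | 𝓖⟧) ω • H t ω := by
  classical
  have hsplit : (fun ω => H (T ω) ω)
      = ∑ t, ({ω' | T ω' = t}.indicator (fun _ => (1 : ℝ))) • H t := by
    ext ω
    simp [Finset.sum_apply, Set.indicator_apply, ite_smul]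
  have hint1 : ∀ t, Integrable ({ω' | T ω' = t}.indicator (fun _ => (1 : ℝ))) μ := fun t =>
    (integrable_const 1).indicator (hT t)
  have hint : ∀ t, Integrable (({ω' | T ω' = t}.indicator (fun _ => (1 : ℝ))) • H t) μ := by
    intro t
    have : ({ω' | T ω' = t}.indicator (fun _ => (1 : ℝ))) • H t
        = {ω' | T ω' = t}.indicator (H t) := by
      ext ω
      by_cases h : T ω = t <;> simp [h]
    rw [this]
    exact ((hH t).integrable hle).indicator (hT t)
  rw [hsplit]
  have h1 := condExp_finsetSum (m := 𝓖) (s := Finset.univ) fun t _ => hint t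
  have h2 : ∀ᵐ ω ∂μ, ∀ t,
      (μ[({ω' | T ω' = t}.indicator (fun _ => (1 : ℝ))) • H t | 𝓖]) ω
        = (μ⟦{ω' | T ω' = t} | 𝓖⟧) ω • H t ω := by
    rw [ae_all_iff]
    intro t
    exact condExp_smul_of_aestronglyMeasurable_right (hint1 t) (hint t)
      (hH t).stronglyMeasurable.aestronglyMeasurable
  filter_upwards [h1, h2] with ω h1 h2
  rw [h1, Finset.sum_apply]
  exact Finset.sum_congr rfl fun t _ => h2 t

lemma sum_condExp_indicator_eq_one {τ : Type*} [Fintype τ] (hle : 𝓖 ≤ mΩ) {T : Ω → τ}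
    (hT : ∀ t, MeasurableSet {ω | T ω = t}) :
    ∀ᵐ ω ∂μ, ∑ t, (μ⟦{ω' | T ω' = t} | 𝓖⟧) ω = 1 := by
  have := condExp_apply_fintype (μ := μ) (E := ℝ) hle hT
    (H := fun _ _ => 1) fun _ => FinMeas.const 1
  rw [condExp_const hle] at this
  filter_upwards [this] with ω h
  simpa using h.symm

variable {n N b : ℕ} {f : Fin N → Eucl n → ℝ}

lemma gradient_avgFun (hf : ∀ i, Differentiable ℝ (f i)) (x : Eucl n) :
    gradient (avgFun f) x = (N : ℝ)⁻¹ • ∑ i, gradient (f i) x := by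
  have h : HasGradientAt (avgFun f) ((N : ℝ)⁻¹ • ∑ i, gradient (f i) x) x := by
    rw [hasGradientAt_iff_hasFDerivAt, map_smul, map_sum]
    have := (HasFDerivAt.fun_sum (u := Finset.univ)
      fun i _ => (hf i x).hasGradientAt.hasFDerivAt).const_mul (N : ℝ)⁻¹
    exact this
  exact h.gradient

lemma vrOracle_sub (hb : 0 < b) (s : Fin b → Fin N) (x xt : Eucl n) :
    vrOracle f s x xt - gradient (avgFun f) x = (b : ℝ)⁻¹ • ∑ j,
      ((gradient (f (s j)) x - gradient (f (s j)) xt)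
        - (gradient (avgFun f) x - gradient (avgFun f) xt)) := by
  have hb' : (b : ℝ) ≠ 0 := by positivity
  rw [vrOracle, batchGrad, batchGrad, Finset.sum_sub_distrib, Finset.sum_sub_distrib,
    Finset.sum_const, Finset.card_univ, Fintype.card_fin, smul_sub, smul_sub,
    ← Nat.cast_smul_eq_nsmul ℝ, inv_smul_smul₀ hb']
  abel

/-- The common law p of the indices need not be uniform. Unbiasedness of the oracle already forces
the p-mean of the gradient differences `a` to be `c`, and centering is all that the second moment
identity needs. -/
lemma sum_iid_norm_vrOracle_sub_sq_le (hb : 0 < b) {L : ℝ≥0}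
    (hL : ∀ i, LipschitzWith L (gradient (f i))) {p : Fin N → ℝ} (hp0 : ∀ i, 0 ≤ p i)
    (hp : ∑ i, p i = 1) (x xt : Eucl n)
    (hmean : ∑ s : Fin b → Fin N, (∏ j, p (s j)) • vrOracle f s x xt
      = gradient (avgFun f) x) :
    ∑ s : Fin b → Fin N, (∏ j, p (s j)) * ‖vrOracle f s x xt - gradient (avgFun f) x‖ ^ 2
      ≤ L ^ 2 * (b : ℝ)⁻¹ * ‖x - xt‖ ^ 2 := by
  have hb' : (b : ℝ) ≠ 0 := by positivity
  set a : Fin N → Eucl n := fun i => gradient (f i) x - gradient (f i) xt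
  set c := gradient (avgFun f) x - gradient (avgFun f) xt
  have hsub : ∀ s : Fin b → Fin N, vrOracle f s x xt - gradient (avgFun f) x
      = (b : ℝ)⁻¹ • ∑ j, (a (s j) - c) := fun s => vrOracle_sub hb s x xt
  have h1 : ∑ s : Fin b → Fin N, (∏ j, p (s j)) • (vrOracle f s x xt
      - gradient (avgFun f) x) = ∑ i, p i • (a i - c) := by
    simp_rw [hsub, smul_comm _ (b : ℝ)⁻¹, ← Finset.smul_sum, sum_prod_smul_sum hp (fun i => a i - c)]
    rw [inv_smul_smul₀ hb']
  have h2 : ∑ i, p i • (a i - c) = 0 := by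
    rw [← h1]
    simp_rw [smul_sub, Finset.sum_sub_distrib, ← Finset.sum_smul]
    rw [hmean, sum_prod_eq_one hp, one_smul, sub_self]
  have h3 : ∑ i, p i • a i = c := by
    simp_rw [smul_sub, Finset.sum_sub_distrib, ← Finset.sum_smul] at h2
    rwa [hp, one_smul, sub_eq_zero] at h2
  have h4 : ∑ s : Fin b → Fin N, (∏ j, p (s j)) *
      ‖vrOracle f s x xt - gradient (avgFun f) x‖ ^ 2 = (b : ℝ)⁻¹ * ∑ i, p i * ‖a i - c‖ ^ 2 := by
    have : ∀ s : Fin b → Fin N, (∏ j, p (s j)) *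
        ‖vrOracle f s x xt - gradient (avgFun f) x‖ ^ 2
        = ((b : ℝ)⁻¹) ^ 2 * ((∏ j, p (s j)) * ‖∑ j, (a (s j) - c)‖ ^ 2) := by
      intro s
      rw [hsub, norm_smul, Real.norm_of_nonneg (by positivity)]
      ring
    simp_rw [this, ← Finset.mul_sum]
    rw [sum_prod_mul_norm_sum_sq hp h2]
    field_simp
  have h5 : ∑ i, p i * ‖a i‖ ^ 2 ≤ L ^ 2 * ‖x - xt‖ ^ 2 := by
    calc ∑ i, p i * ‖a i‖ ^ 2 ≤ ∑ i, p i * (L * ‖x - xt‖) ^ 2 := by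
          gcongr with i
          · exact hp0 i
          · exact (hL i).norm_sub_le x xt
      _ = L ^ 2 * ‖x - xt‖ ^ 2 := by rw [← Finset.sum_mul, hp]; ring
  rw [h4]
  calc (b : ℝ)⁻¹ * ∑ i, p i * ‖a i - c‖ ^ 2 ≤ (b : ℝ)⁻¹ * (L ^ 2 * ‖x - xt‖ ^ 2) := by
        gcongr
        exact (sum_mul_norm_sub_sq_le hp h3).trans h5
    _ = _ := by ring

/-- Here the deviations are centered because ∇f is the uniform average of the ∇f_i. -/
lemma sum_subset_norm_vrOracle_sub_sq_le (hN : 0 < N) (hb : 0 < b) (hbN : b ≤ N) {L : ℝ≥0}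
    (hf : ∀ i, Differentiable ℝ (f i)) (hL : ∀ i, LipschitzWith L (gradient (f i)))
    (x xt : Eucl n) :
    ∑ A ∈ Finset.univ.powersetCard b, ((N.choose b : ℕ) : ℝ)⁻¹ *
      ‖(b : ℝ)⁻¹ • ∑ i ∈ A, ((gradient (f i) x - gradient (f i) xt)
        - (gradient (avgFun f) x - gradient (avgFun f) xt))‖ ^ 2
      ≤ L ^ 2 * (b : ℝ)⁻¹ * ‖x - xt‖ ^ 2 := by
  have hN' : (0 : ℝ) < N := by positivity
  have hb' : (0 : ℝ) < b := by positivity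
  have hch : (0 : ℝ) < (N.choose b : ℕ) := by exact_mod_cast Nat.choose_pos hbN
  set a : Fin N → Eucl n := fun i => gradient (f i) x - gradient (f i) xt
  set c := gradient (avgFun f) x - gradient (avgFun f) xt with hc
  have hp : ∑ _i : Fin N, (N : ℝ)⁻¹ = 1 := by simp [hN'.ne']
  have h3 : ∑ i, (N : ℝ)⁻¹ • a i = c := by
    rw [hc, gradient_avgFun hf, gradient_avgFun hf, ← smul_sub, ← Finset.sum_sub_distrib,
      Finset.smul_sum]
  have hy : ∑ i, (a i - c) = 0 := by
    rw [Finset.sum_sub_distrib, Finset.sum_const, Finset.card_univ, Fintype.card_fin, ← h3,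
      ← Finset.smul_sum, ← Nat.cast_smul_eq_nsmul ℝ, smul_inv_smul₀ hN'.ne', sub_self]
  have h1 := sum_powersetCard_norm_sum_sq_le hy b
  have h2 := sum_mul_norm_sub_sq_le hp h3
  rw [← Finset.mul_sum, ← Finset.mul_sum] at h2
  rw [Fintype.card_fin] at h1
  have h5 : ∑ i, ‖a i‖ ^ 2 ≤ N * (L ^ 2 * ‖x - xt‖ ^ 2) := by
    calc ∑ i, ‖a i‖ ^ 2 ≤ ∑ _i : Fin N, (L * ‖x - xt‖) ^ 2 := by
          gcongr with i
          exact (hL i).norm_sub_le x xt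
      _ = _ := by
          rw [Finset.sum_const, Finset.card_univ, Fintype.card_fin, nsmul_eq_mul]; ring
  have h6 : ∑ i, ‖a i - c‖ ^ 2 ≤ N * (L ^ 2 * ‖x - xt‖ ^ 2) :=
    (le_of_mul_le_mul_left h2 (by positivity)).trans h5
  change ∑ A ∈ Finset.univ.powersetCard b, ((N.choose b : ℕ) : ℝ)⁻¹ *
      ‖(b : ℝ)⁻¹ • ∑ i ∈ A, (a i - c)‖ ^ 2 ≤ _
  rw [← Finset.mul_sum]
  have h7 : ∀ A : Finset (Fin N), ‖(b : ℝ)⁻¹ • ∑ i ∈ A, (a i - c)‖ ^ 2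
      = ((b : ℝ)⁻¹) ^ 2 * ‖∑ i ∈ A, (a i - c)‖ ^ 2 := by
    intro A
    rw [norm_smul, Real.norm_of_nonneg (by positivity)]
    ring
  simp_rw [h7]
  rw [← Finset.mul_sum]
  set Y := ∑ A ∈ Finset.univ.powersetCard b, ‖∑ i ∈ A, (a i - c)‖ ^ 2
  have h8 : Y ≤ b * (N.choose b : ℕ) * (L ^ 2 * ‖x - xt‖ ^ 2) := by
    refine le_of_mul_le_mul_left (h1.trans ?_) hN'
    calc (b : ℝ) * (N.choose b : ℕ) * ∑ i, ‖a i - c‖ ^ 2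
        ≤ b * (N.choose b : ℕ) * (N * (L ^ 2 * ‖x - xt‖ ^ 2)) := by gcongr
      _ = _ := by ring
  calc ((N.choose b : ℕ) : ℝ)⁻¹ * (((b : ℝ)⁻¹) ^ 2 * Y)
      ≤ ((N.choose b : ℕ) : ℝ)⁻¹ * (((b : ℝ)⁻¹) ^ 2 *
        (b * (N.choose b : ℕ) * (L ^ 2 * ‖x - xt‖ ^ 2))) := by gcongr
    _ = _ := by field_simp

/-- The conditional variance of the variance-reduced mini-batch oracle. -/
lemma IsMiniBatch.condExp_norm_vrOracle_sub_sq_le (hle : 𝓖 ≤ mΩ) (hN : 0 < N) (hb : 0 < b)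
    {L : ℝ≥0} (hf : ∀ i, Differentiable ℝ (f i)) (hL : ∀ i, LipschitzWith L (gradient (f i)))
    {S : Ω → Fin b → Fin N} (hS : Measurable S) (hbatch : IsMiniBatch 𝓖 μ S)
    {x xt : Ω → Eucl n} (hx : FinMeas 𝓖 x) (hxt : FinMeas 𝓖 xt)
    (hmean : μ[fun ω => vrOracle f (S ω) (x ω) (xt ω) | 𝓖] =ᵐ[μ]
      fun ω => gradient (avgFun f) (x ω)) :
    μ[fun ω => ‖vrOracle f (S ω) (x ω) (xt ω) - gradient (avgFun f) (x ω)‖ ^ 2 | 𝓖] ≤ᵐ[μ]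
      fun ω => L ^ 2 * (b : ℝ)⁻¹ * ‖x ω - xt ω‖ ^ 2 := by
  classical
  have hSt : ∀ s, MeasurableSet {ω | S ω = s} := fun s => hS (measurableSet_singleton s)
  have hSj : ∀ j i, MeasurableSet {ω | S ω j = i} := fun j i =>
    (measurable_pi_apply j).comp hS (measurableSet_singleton i)
  rcases hbatch with ⟨hid, hind⟩ | ⟨hinj, hunif⟩
  · have h1 := condExp_apply_fintype (μ := μ) hle hSt
      (H := fun s ω => ‖vrOracle f s (x ω) (xt ω) - gradient (avgFun f) (x ω)‖ ^ 2)
      fun s => hx.map₂ hxt fun a c => ‖vrOracle f s a c - gradient (avgFun f) a‖ ^ 2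
    have h2 := condExp_apply_fintype (μ := μ) hle hSt
      (H := fun s ω => vrOracle f s (x ω) (xt ω))
      fun s => hx.map₂ hxt fun a c => vrOracle f s a c
    have h3 := sum_condExp_indicator_eq_one (μ := μ) hle (hSj ⟨0, hb⟩)
    have h4 : ∀ᵐ ω ∂μ, ∀ j i, (μ⟦{ω | S ω j = i} | 𝓖⟧) ω = (μ⟦{ω | S ω ⟨0, hb⟩ = i} | 𝓖⟧) ω :=
      ae_all_iff.mpr fun j => ae_all_iff.mpr fun i => hid j ⟨0, hb⟩ i
    have h5 : ∀ᵐ ω ∂μ, ∀ s : Fin b → Fin N, (μ⟦{ω | S ω = s} | 𝓖⟧) ω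
        = ∏ j, (μ⟦{ω' | S ω' j = s j} | 𝓖⟧) ω := ae_all_iff.mpr fun s => hind s
    have h6 : ∀ᵐ ω ∂μ, ∀ i, 0 ≤ (μ⟦{ω | S ω ⟨0, hb⟩ = i} | 𝓖⟧) ω :=
      ae_all_iff.mpr fun i => condExp_nonneg
        (ae_of_all _ fun ω => Set.indicator_nonneg (fun _ _ => zero_le_one) ω)
    filter_upwards [h1, h2, h3, h4, h5, h6, hmean] with ω h1 h2 h3 h4 h5 h6 hm
    simp_rw [h5, h4, smul_eq_mul] at h1
    simp_rw [h5, h4] at h2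
    rw [h1]
    exact sum_iid_norm_vrOracle_sub_sq_le hb hL h6 h3 _ _ (h2.symm.trans hm)
  · have hbN : b ≤ N := by
      obtain ⟨ω, h⟩ := hinj.exists
      simpa using Fintype.card_le_of_injective _ h
    set G : Finset (Fin N) → Eucl n → Eucl n → ℝ := fun A a c =>
      ‖(b : ℝ)⁻¹ • ∑ i ∈ A, ((gradient (f i) a - gradient (f i) c)
        - (gradient (avgFun f) a - gradient (avgFun f) c))‖ ^ 2 with hG
    have hTt : ∀ A, MeasurableSet {ω | Finset.univ.image (S ω) = A} := fun A =>
      hS (Set.toFinite {s : Fin b → Fin N | Finset.univ.image s = A}).measurableSet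
    -- Only the law of the sampled set is prescribed, not that of its ordering. Since almost every
    -- sample is injective, the oracle error depends on the set alone.
    have h0 : (fun ω => ‖vrOracle f (S ω) (x ω) (xt ω) - gradient (avgFun f) (x ω)‖ ^ 2) =ᵐ[μ]
        fun ω => G (Finset.univ.image (S ω)) (x ω) (xt ω) := by
      filter_upwards [hinj] with ω h
      rw [vrOracle_sub hb, hG]
      simp only
      rw [Finset.sum_image fun _ _ _ _ h' => h h']
    have h1 := condExp_apply_fintype (μ := μ) hle hTt
      (H := fun A ω => G A (x ω) (xt ω)) fun A => hx.map₂ hxt (G A)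
    have h2 : ∀ᵐ ω ∂μ, ∀ A : Finset (Fin N), A.card = b →
        (μ⟦{ω | Finset.univ.image (S ω) = A} | 𝓖⟧) ω = ((N.choose b : ℕ) : ℝ)⁻¹ :=
      ae_all_iff.mpr fun A => by
        by_cases hA : A.card = b
        · filter_upwards [hunif A hA] with ω h _ using h
        · exact ae_of_all _ fun ω h => absurd h hA
    -- Sets of the wrong size have conditional probability zero, which cuts the sum over all subsets
    -- down to those of size b.
    have h3 : ∀ᵐ ω ∂μ, ∀ A : Finset (Fin N), A.card ≠ b →
        (μ⟦{ω | Finset.univ.image (S ω) = A} | 𝓖⟧) ω = 0 :=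
      ae_all_iff.mpr fun A => by
        by_cases hA : A.card = b
        · exact ae_of_all _ fun ω h => absurd hA h
        · have : {ω | Finset.univ.image (S ω) = A}.indicator (fun _ => (1 : ℝ)) =ᵐ[μ] 0 := by
            filter_upwards [hinj] with ω h
            refine Set.indicator_of_notMem (fun h' => hA ?_) _
            rw [← (h' : Finset.univ.image (S ω) = A), Finset.card_image_of_injective _ h,
              Finset.card_univ, Fintype.card_fin]
          have h' := condExp_congr_ae (m := 𝓖) this
          rw [condExp_zero] at h'
          filter_upwards [h'] with ω h _ using h
    filter_upwards [condExp_congr_ae (m := 𝓖) h0, h1, h2, h3] with ω h0 h1 h2 h3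
    rw [h0, h1]
    refine le_trans (le_of_eq ?_)
      (sum_subset_norm_vrOracle_sub_sq_le hN hb hbN hf hL (x ω) (xt ω))
    symm
    refine Finset.sum_subset_zero_on_sdiff (Finset.subset_univ _) (fun A hA => ?_) fun A hA => ?_
    · rw [h3 A fun h => (Finset.mem_sdiff.mp hA).2
        (Finset.mem_powersetCard.mpr ⟨Finset.subset_univ _, h⟩), zero_smul]
    · rw [h2 A (Finset.mem_powersetCard.mp hA).2, smul_eq_mul]

/-- Integrated form of the variance bound. -/
lemma IsMiniBatch.setIntegral_norm_vrOracle_sub_sq_le (hle : 𝓖 ≤ mΩ) (hN : 0 < N) (hb : 0 < b)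
    {L : ℝ≥0} (hf : ∀ i, Differentiable ℝ (f i)) (hL : ∀ i, LipschitzWith L (gradient (f i)))
    {S : Ω → Fin b → Fin N} (hS : Measurable S) (hbatch : IsMiniBatch 𝓖 μ S)
    {x xt : Ω → Eucl n} (hx : FinMeas 𝓖 x) (hxt : FinMeas 𝓖 xt)
    (hmean : μ[fun ω => vrOracle f (S ω) (x ω) (xt ω) | 𝓖] =ᵐ[μ]
      fun ω => gradient (avgFun f) (x ω))
    (hint : Integrable (fun ω =>
      ‖vrOracle f (S ω) (x ω) (xt ω) - gradient (avgFun f) (x ω)‖ ^ 2) μ)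
    {A : Set Ω} (hA : MeasurableSet[𝓖] A) :
    ∫ ω in A, ‖vrOracle f (S ω) (x ω) (xt ω) - gradient (avgFun f) (x ω)‖ ^ 2 ∂μ ≤
      L ^ 2 * (b : ℝ)⁻¹ * ∫ ω in A, ‖x ω - xt ω‖ ^ 2 ∂μ := by
  rw [← setIntegral_condExp hle hint hA, ← integral_const_mul]
  refine integral_mono_ae integrable_condExp.integrableOn ?_
    (ae_restrict_of_ae (hbatch.condExp_norm_vrOracle_sub_sq_le hle hN hb hf hL hS hx hxt hmean))
  exact ((hx.map₂ hxt fun a c => L ^ 2 * (b : ℝ)⁻¹ * ‖a - c‖ ^ 2).integrable hle).integrableOn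

/-- A conditionally unbiased estimator is orthogonal to the past. -/
lemma setIntegral_inner_sub_eq_zero {E : Type*} [NormedAddCommGroup E] [InnerProductSpace ℝ E]
    [CompleteSpace E] (hle : 𝓖 ≤ mΩ) {W V g : Ω → E} (hW : FinMeas 𝓖 W) (hg : FinMeas 𝓖 g)
    (hV : Integrable V μ) (hWV : Integrable (fun ω => inner ℝ (W ω) (V ω - g ω)) μ)
    (hmean : μ[V | 𝓖] =ᵐ[μ] g) {A : Set Ω} (hA : MeasurableSet[𝓖] A) :
    ∫ ω in A, inner ℝ (W ω) (V ω - g ω) ∂μ = 0 := by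
  have hgi := hg.integrable (μ := μ) hle
  rw [← setIntegral_condExp hle hWV hA]
  have h1 : μ[fun ω => V ω - g ω | 𝓖] =ᵐ[μ] 0 := by
    filter_upwards [condExp_sub hV hgi 𝓖, hmean] with ω h1 h2
    refine h1.trans ?_
    rw [Pi.sub_apply, h2, condExp_of_stronglyMeasurable hle hg.stronglyMeasurable hgi,
      sub_self]
    rfl
  have h2 := condExp_bilin_of_aestronglyMeasurable_left (m := 𝓖) (innerSL ℝ)
    hW.stronglyMeasurable.aestronglyMeasurable hWV (hV.sub hgi)
  have h3 : μ[fun ω => inner ℝ (W ω) (V ω - g ω) | 𝓖] =ᵐ[μ] 0 := by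
    filter_upwards [h1, h2] with ω h1 h2
    refine h2.trans ?_
    rw [h1]
    simp
  rw [integral_congr_ae (ae_restrict_of_ae h3)]
  simp

end CondMoments

/-! ### One step of the method -/

/-- The objective as a real function; it agrees with `psi` on `dom φ`. -/
def psiReal {n N : ℕ} (f : Fin N → Eucl n → ℝ) (φ : Eucl n → EReal) (x : Eucl n) : ℝ :=
  avgFun f x + (φ x).toReal

lemma IsConvexLscProper.psi_eq_coe {n N : ℕ} (f : Fin N → Eucl n → ℝ) {φ : Eucl n → EReal}
    (hφ : IsConvexLscProper φ) {x : Eucl n} (hx : φ x ≠ ⊤) : psi f φ x = (psiReal f φ x : EReal) := by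
  rw [psi, psiReal, EReal.coe_add, hφ.coe_toReal hx]

lemma differentiable_avgFun {n N : ℕ} {f : Fin N → Eucl n → ℝ}
    (hf : ∀ i, Differentiable ℝ (f i)) : Differentiable ℝ (avgFun f) := by
  unfold avgFun
  exact (Differentiable.fun_sum fun i _ => hf i).const_mul _

section OneStep

variable {n N : ℕ} {f : Fin N → Eucl n → ℝ} {φ : Eucl n → EReal} {Lf : ℝ≥0}

/-- The point y = prox_{lam φ}(x - lam v) mediates: testing the prox inequality of `xn` with y, and
that of y with x, cancels φ(y) and ⟨g, F⟩. Squared errors go through Young's inequality, while the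
inner products with `vp - gz` and `v - g` are kept exact: their other factors are known before the
respective sample, so they will have mean zero. -/
lemma psiReal_step_le (hφ : IsConvexLscProper φ) (hf : ∀ i, Differentiable ℝ (f i))
    (hLf : LipschitzWith Lf (gradient (avgFun f))) {lam lp α β : ℝ} (hlam : 0 < lam)
    (hlp : 0 < lp) (hα : 0 ≤ α) (hβ : 0 ≤ β) {x : Eucl n} (hx : φ x ≠ ⊤)
    (d v vp z xn g gz F Fb : Eucl n) (hz : z = x + β • d)
    (hxn : xn = prox φ lp (x + α • d - lp • vp))
    (hg : g = gradient (avgFun f) x) (hgz : gz = gradient (avgFun f) z)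
    (hF : F = proxResidual φ lam v x) (hFb : Fb = proxResidual φ lam g x) :
    psiReal f φ xn ≤ psiReal f φ x - (lp⁻¹ - Lf) / 2 * ‖xn - x‖ ^ 2
      + (lp⁻¹ / 2 - 3 / 4 * lam⁻¹) * ‖F‖ ^ 2 + lp⁻¹ / 2 * (α + Lf * β * lp) ^ 2 * ‖d‖ ^ 2
      + lp / 2 * ‖vp - gz‖ ^ 2 - inner ℝ (α • d + lp • (g - gz)) (vp - gz)
      + 3 / 4 * lam * ‖v - g‖ ^ 2 + 1 / 2 * inner ℝ Fb (v - g) := by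
  have hy := hφ.prox_ne_top hlam (x - lam • v)
  have h1 := hφ.prox_le hlp (x + α • d - lp • vp) hy
  have h2 := hφ.prox_le hlam (x - lam • v) hx
  have h3 := le_quadratic_of_lipschitzWith_gradient (differentiable_avgFun hf) hLf x xn
  have h4 := hφ.norm_proxResidual_sub_le hlam v g x
  rw [← hxn] at h1
  rw [← hg] at h3
  rw [← hF, ← hFb] at h4
  set y := prox φ lam (x - lam • v) with hyd
  have hFy : F = x - y := hF
  set Δ := xn - x with hΔ
  set e := vp - gz with he
  set Q := α • d + lp • (g - gz) with hQ
  set w := v - g with hw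
  have hP : xn - y = Δ + F := by rw [hFy, hΔ]; abel
  have e1 : x + α • d - lp • vp - xn = -Δ + Q - lp • e - lp • g := by
    rw [hΔ, hQ, he]; module
  have e2 : x - lam • v - y = F - lam • w - lam • g := by rw [hFy, hw]; module
  have e3 : y - x = -F := by rw [hFy]; abel
  rw [e1, hP] at h1
  rw [e2, e3] at h2
  have hQn : ‖Q‖ ≤ (α + Lf * β * lp) * ‖d‖ := by
    have h5 : ‖g - gz‖ ≤ Lf * (β * ‖d‖) := by
      rw [hg, hgz]
      refine (hLf.norm_sub_le _ _).trans (le_of_eq ?_)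
      rw [hz, sub_add_cancel_left, norm_neg, norm_smul, Real.norm_of_nonneg hβ]
    calc ‖Q‖ ≤ ‖α • d‖ + ‖lp • (g - gz)‖ := norm_add_le _ _
      _ = α * ‖d‖ + lp * ‖g - gz‖ := by
          rw [norm_smul, norm_smul, Real.norm_of_nonneg hα, Real.norm_of_nonneg hlp.le]
      _ ≤ α * ‖d‖ + lp * (Lf * (β * ‖d‖)) := by gcongr
      _ = _ := by ring
  have hQ2 : ‖Q‖ ^ 2 ≤ (α + Lf * β * lp) ^ 2 * ‖d‖ ^ 2 := by
    rw [← mul_pow]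
    exact pow_le_pow_left₀ (norm_nonneg _) hQn 2
  -- Young's inequality for the error terms of the extrapolated step
  have hY : 0 ≤ ‖(Δ + F) - (Q - lp • e)‖ ^ 2 := by positivity
  have hYe : ‖(Δ + F) - (Q - lp • e)‖ ^ 2 = ‖Δ + F‖ ^ 2 - 2 * inner ℝ (Q - lp • e) (Δ + F)
      + (‖Q‖ ^ 2 - 2 * (lp * inner ℝ Q e) + lp ^ 2 * ‖e‖ ^ 2) := by
    rw [norm_sub_sq_real, norm_sub_sq_real, norm_smul, Real.norm_of_nonneg hlp.le,
      real_inner_smul_right, real_inner_comm]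
    ring
  -- This form cancels the term ⟨Δ, Δ + F⟩ of the prox inequality and leaves exactly -‖Δ‖² + ‖F‖²,
  -- up to the factor lp⁻¹ / 2.
  have hPn : ‖Δ + F‖ ^ 2 = 2 * inner ℝ Δ (Δ + F) - ‖Δ‖ ^ 2 + ‖F‖ ^ 2 := by
    rw [norm_add_sq_real, inner_add_right, real_inner_self_eq_norm_sq]
    ring
  have h1' : lp⁻¹ * inner ℝ (-Δ + Q - lp • e - lp • g) (Δ + F)
      = lp⁻¹ * (inner ℝ (Q - lp • e) (Δ + F) - inner ℝ Δ (Δ + F)) - inner ℝ g Δ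
        - inner ℝ g F := by
    have : -Δ + Q - lp • e - lp • g = (Q - lp • e) - Δ - lp • g := by abel
    rw [this, inner_sub_left, inner_sub_left (Q - lp • e), real_inner_smul_left,
      inner_add_right g]
    field_simp
    ring
  have h2' : lam⁻¹ * inner ℝ (F - lam • w - lam • g) (-F)
      = - lam⁻¹ * ‖F‖ ^ 2 + inner ℝ w F + inner ℝ g F := by
    rw [inner_neg_right, inner_sub_left, inner_sub_left, real_inner_smul_left,
      real_inner_smul_left, real_inner_self_eq_norm_sq]
    field_simp
    ring
  rw [h1'] at h1
  rw [h2'] at h2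
  -- two bounds for the error term of the oracle at `x`
  have hw1 : inner ℝ w F ≤ lam⁻¹ / 2 * ‖F‖ ^ 2 + lam / 2 * ‖w‖ ^ 2 := by
    have h5 : 0 ≤ lam⁻¹ / 2 * ‖F - lam • w‖ ^ 2 := by positivity
    rw [norm_sub_sq_real, norm_smul, Real.norm_of_nonneg hlam.le, real_inner_smul_right,
      real_inner_comm] at h5
    have h6 : lam⁻¹ / 2 * (‖F‖ ^ 2 - 2 * (lam * inner ℝ w F) + (lam * ‖w‖) ^ 2)
        = lam⁻¹ / 2 * ‖F‖ ^ 2 - inner ℝ w F + lam / 2 * ‖w‖ ^ 2 := by field_simp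
    linarith
  have hw2 : inner ℝ w F ≤ inner ℝ Fb w + lam * ‖w‖ ^ 2 := by
    have h5 := real_inner_le_norm (F - Fb) w
    have h6 := mul_le_mul_of_nonneg_right h4 (norm_nonneg w)
    rw [inner_sub_left] at h5
    rw [real_inner_comm]
    linarith
  have hYl := mul_nonneg (show 0 ≤ lp⁻¹ / 2 by positivity) hY
  rw [hYe] at hYl
  have hYl' : lp⁻¹ * inner ℝ (Q - lp • e) (Δ + F) ≤ lp⁻¹ / 2 * ‖Δ + F‖ ^ 2
      + lp⁻¹ / 2 * ‖Q‖ ^ 2 - inner ℝ Q e + lp / 2 * ‖e‖ ^ 2 := by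
    have : lp⁻¹ / 2 * (‖Δ + F‖ ^ 2 - 2 * inner ℝ (Q - lp • e) (Δ + F)
      + (‖Q‖ ^ 2 - 2 * (lp * inner ℝ Q e) + lp ^ 2 * ‖e‖ ^ 2))
      = lp⁻¹ / 2 * ‖Δ + F‖ ^ 2 - lp⁻¹ * inner ℝ (Q - lp • e) (Δ + F) + lp⁻¹ / 2 * ‖Q‖ ^ 2
        - inner ℝ Q e + lp / 2 * ‖e‖ ^ 2 := by
      field_simp
      ring
    linarith
  have hQ3 : lp⁻¹ / 2 * ‖Q‖ ^ 2 ≤ lp⁻¹ / 2 * (α + Lf * β * lp) ^ 2 * ‖d‖ ^ 2 := by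
    rw [mul_assoc]
    gcongr
  rw [hPn] at hYl'
  unfold psiReal
  -- `hw1` and `hw2` are averaged with weight 1/2 each. This turns -lam⁻¹ into -3/4 lam⁻¹ and
  -- produces 3/4 lam ‖w‖² and half of ⟨Fb, w⟩, where `Fb`, unlike F, does not involve v.
  linarith

lemma mul_sq_le_of_mul_le {lam a c w : ℝ} (hlam : 0 < lam) (ha : 0 ≤ a)
    (h : lam * a ≤ c + lam * w) : lam * a ^ 2 ≤ 2 * lam⁻¹ * c ^ 2 + 2 * lam * w ^ 2 := by
  have h5 : (lam * a) ^ 2 ≤ (c + lam * w) ^ 2 := pow_le_pow_left₀ (by positivity) h 2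
  have h6 : (lam * a) ^ 2 ≤ 2 * c ^ 2 + 2 * (lam * w) ^ 2 :=
    h5.trans (add_sq_le.trans_eq (by ring))
  refine le_of_mul_le_mul_left ?_ hlam
  have : lam * (2 * lam⁻¹ * c ^ 2 + 2 * lam * w ^ 2) = 2 * c ^ 2 + 2 * (lam * w) ^ 2 := by
    field_simp
  linarith

/-- Passing from prox parameter 1 to lam costs a factor lam⁻¹, and replacing the gradient by v costs
lam ‖v - ∇f(x)‖; the sum is squared and divided by lam. -/
lemma mul_norm_exactResidual_sq_le (hφ : IsConvexLscProper φ) {lam : ℝ} (hlam : 0 < lam)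
    (hlam1 : lam ≤ 1) (v x : Eucl n) :
    lam * ‖exactResidual f φ x‖ ^ 2 ≤ 2 * lam⁻¹ * ‖proxResidual φ lam v x‖ ^ 2
      + 2 * lam * ‖v - gradient (avgFun f) x‖ ^ 2 := by
  have h1 := hφ.mul_norm_proxResidual_one_le hlam hlam1 (gradient (avgFun f) x) x
  have h2 := hφ.norm_proxResidual_sub_le hlam v (gradient (avgFun f) x) x
  have h3 := norm_sub_norm_le (proxResidual φ lam (gradient (avgFun f) x) x)
    (proxResidual φ lam v x)
  rw [norm_sub_rev] at h3
  exact mul_sq_le_of_mul_le hlam (norm_nonneg _) (h1.trans (by linarith))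

lemma norm_exactResidual_sub_le (hφ : IsConvexLscProper φ)
    (hLf : LipschitzWith Lf (gradient (avgFun f))) (x y : Eucl n) :
    ‖exactResidual f φ x - exactResidual f φ y‖ ≤ (2 + Lf) * ‖x - y‖ := by
  have h1 := hφ.norm_prox_sub_prox_le one_pos (x - (1 : ℝ) • gradient (avgFun f) x)
    (y - (1 : ℝ) • gradient (avgFun f) y)
  have h2 := hLf.norm_sub_le x y
  unfold exactResidual proxResidual
  set p := prox φ 1 (x - (1 : ℝ) • gradient (avgFun f) x)
  set q := prox φ 1 (y - (1 : ℝ) • gradient (avgFun f) y)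
  have e1 : x - p - (y - q) = (x - y) - (p - q) := by abel
  have e2 : x - (1 : ℝ) • gradient (avgFun f) x - (y - (1 : ℝ) • gradient (avgFun f) y)
      = (x - y) - (gradient (avgFun f) x - gradient (avgFun f) y) := by module
  rw [e2] at h1
  rw [e1]
  have h3 := norm_sub_le (x - y) (p - q)
  have h4 := norm_sub_le (x - y) (gradient (avgFun f) x - gradient (avgFun f) y)
  linarith

end OneStep

/-! ### Measurability along the run -/

namespace VRProcess

variable {n N : ℕ} {P : VRParams n} {Ω : Type*} (R : VRProcess P N Ω)

lemma comap_S_le_sigmaBefore {m k i j : ℕ} (hj : j < P.K i) (h : i < m ∨ (i = m ∧ j < k)) :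
    MeasurableSpace.comap (R.S i j) inferInstance ⊔
      MeasurableSpace.comap (R.SPlus i j) inferInstance ≤ R.sigmaBefore m k :=
  le_iSup_of_le i <| le_iSup_of_le j <| le_iSup_of_le ⟨hj, h⟩ le_rfl

lemma sigmaBefore_mono {m k m' k' : ℕ}
    (h : ∀ i j, j < P.K i → (i < m ∨ (i = m ∧ j < k)) → (i < m' ∨ (i = m' ∧ j < k'))) :
    R.sigmaBefore m k ≤ R.sigmaBefore m' k' :=
  iSup_le fun i => iSup_le fun j => iSup_le fun hij =>
    R.comap_S_le_sigmaBefore hij.1 (h i j hij.1 hij.2)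

lemma sigmaBefore_le_of_le {m k k' : ℕ} (h : k ≤ k') :
    R.sigmaBefore m k ≤ R.sigmaBefore m k' :=
  R.sigmaBefore_mono fun i j _ hij => by omega

lemma sigmaBefore_le_succ (m k : ℕ) : R.sigmaBefore m k ≤ R.sigmaBefore (m + 1) 0 :=
  R.sigmaBefore_mono fun i j _ hij => by omega

lemma sigmaBefore_le_sigmaUpTo (m k : ℕ) : R.sigmaBefore m k ≤ R.sigmaUpTo m k := le_sup_left

lemma sigmaUpTo_le_sigmaBefore {m k : ℕ} (hk : k < P.K m) :
    R.sigmaUpTo m k ≤ R.sigmaBefore m (k + 1) :=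
  sup_le (R.sigmaBefore_le_of_le (Nat.le_succ k))
    (le_sup_left.trans (R.comap_S_le_sigmaBefore hk (Or.inr ⟨rfl, Nat.lt_succ_self k⟩)))

/-- All samples of the first `m + 1` outer loops. -/
def allSamples (m : ℕ) (ω : Ω) :
    (i : Fin (m + 1)) → (j : Fin (P.K i)) → (Fin (P.b i) → Fin N) × (Fin (P.bPlus i) → Fin N) :=
  fun i j => (R.S i j ω, R.SPlus i j ω)

lemma comap_S_le_comap_allSamples {m i j : ℕ} (hi : i ≤ m) (hj : j < P.K i) :
    MeasurableSpace.comap (R.S i j) inferInstance ⊔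
      MeasurableSpace.comap (R.SPlus i j) inferInstance ≤
        MeasurableSpace.comap (R.allSamples m) ⊤ := by
  refine sup_le ?_ ?_
  · rintro _ ⟨t, -, rfl⟩
    exact ⟨{p | (p ⟨i, Nat.lt_succ_of_le hi⟩ ⟨j, hj⟩).1 ∈ t}, trivial, rfl⟩
  · rintro _ ⟨t, -, rfl⟩
    exact ⟨{p | (p ⟨i, Nat.lt_succ_of_le hi⟩ ⟨j, hj⟩).2 ∈ t}, trivial, rfl⟩

lemma sigmaUpTo_le_comap_allSamples {m k : ℕ} (hk : k < P.K m) :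
    R.sigmaUpTo m k ≤ MeasurableSpace.comap (R.allSamples m) ⊤ := by
  refine sup_le (iSup_le fun i => iSup_le fun j => iSup_le fun hij => ?_)
    (le_sup_left.trans (R.comap_S_le_comap_allSamples le_rfl hk))
  exact R.comap_S_le_comap_allSamples (by omega) hij.1

lemma finMeas_S (m k : ℕ) : FinMeas (R.sigmaUpTo m k) (R.S m k) :=
  ⟨Set.toFinite _, fun s => by
    have : MeasurableSet[MeasurableSpace.comap (R.S m k) inferInstance] (R.S m k ⁻¹' s) :=
      ⟨s, (Set.toFinite s).measurableSet, rfl⟩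
    exact (le_sup_right : _ ≤ R.sigmaUpTo m k) _ this⟩

lemma finMeas_SPlus {m k : ℕ} (hk : k < P.K m) :
    FinMeas (R.sigmaBefore m (k + 1)) (R.SPlus m k) :=
  ⟨Set.toFinite _, fun s => by
    have : MeasurableSet[MeasurableSpace.comap (R.SPlus m k) inferInstance]
        (R.SPlus m k ⁻¹' s) := ⟨s, (Set.toFinite s).measurableSet, rfl⟩
    exact (le_sup_right.trans
      (R.comap_S_le_sigmaBefore hk (Or.inr ⟨rfl, Nat.lt_succ_self k⟩))) _ this⟩

variable {R}

lemma HasRandomSamples.sigmaBefore_le [mΩ : MeasurableSpace Ω] {μ : Measure Ω}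
    (hS : R.HasRandomSamples μ) (m k : ℕ) : R.sigmaBefore m k ≤ mΩ :=
  iSup_le fun i => iSup_le fun j => iSup_le fun hij =>
    sup_le (hS.meas i j hij.1).comap_le (hS.measPlus i j hij.1).comap_le

lemma HasRandomSamples.sigmaUpTo_le [mΩ : MeasurableSpace Ω] {μ : Measure Ω}
    (hS : R.HasRandomSamples μ) {m k : ℕ} (hk : k < P.K m) : R.sigmaUpTo m k ≤ mΩ :=
  sup_le (hS.sigmaBefore_le m k) (hS.meas m k hk).comap_le

end VRProcess

section Run

variable {n N : ℕ} {P : VRParams n} {Ω : Type*} {R : VRProcess P N Ω}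
  {f : Fin N → Eucl n → ℝ} {φ : Eucl n → EReal}

/-- The σ-algebra is generated by finitely many finite-valued samples, so (C.2) makes the direction
itself finite-valued and hence square integrable. -/
lemma AssumptionC2.finMeas_D (hC2 : AssumptionC2 R) {m k : ℕ} (hk : k < P.K m) :
    FinMeas (R.sigmaUpTo m k) (R.D m k) :=
  FinMeas.of_measurable (R.sigmaUpTo_le_comap_allSamples hk) (hC2 m k hk)

lemma VRProcess.IsGenerated.finMeas_X (hR : R.IsGenerated f φ) (hC2 : AssumptionC2 R) (m : ℕ) :
    ∀ k ≤ P.K m, FinMeas (R.sigmaBefore m k) (R.X m k) := by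
  have hstep : ∀ m, FinMeas (R.sigmaBefore m 0) (R.X m 0) →
      ∀ k ≤ P.K m, FinMeas (R.sigmaBefore m k) (R.X m k) := by
    intro m h0 k
    induction k with
    | zero => exact fun _ => h0
    | succ k ih =>
      intro hk
      have hk' : k < P.K m := hk
      have hX := (ih hk'.le).mono (R.sigmaBefore_le_of_le (Nat.le_succ k))
      have hD := (hC2.finMeas_D hk').mono (R.sigmaUpTo_le_sigmaBefore hk')
      have hXt := h0.mono (R.sigmaBefore_le_of_le (Nat.zero_le (k + 1)))
      have h := ((hX.prodMk hD).prodMk ((R.finMeas_SPlus hk').prodMk hXt)).comp fun p =>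
        prox φ (P.lamPlus m) (p.1.1 + P.alpha m k • p.1.2
          - P.lamPlus m • vrOracle f p.2.1 (p.1.1 + P.beta m k • p.1.2) p.2.2)
      have e : R.X m (k + 1) = _ := funext fun ω => hR.inner m k hk' ω
      rw [e]
      exact h
  induction m with
  | zero =>
    refine hstep 0 ?_
    have e : R.X 0 0 = fun _ => P.x0 := funext hR.init
    rw [e]
    exact FinMeas.const _
  | succ m ih =>
    refine hstep (m + 1) ?_
    have e : R.X (m + 1) 0 = R.X m (P.K m) := funext (hR.outer m)
    rw [e]
    exact (ih _ le_rfl).mono (R.sigmaBefore_le_succ m _)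

lemma VRProcess.IsGenerated.X_ne_top (hR : R.IsGenerated f φ) (hφ : IsConvexLscProper φ)
    (hP : P.Admissible φ) (m : ℕ) : ∀ k ≤ P.K m, ∀ ω, φ (R.X m k ω) ≠ ⊤ := by
  have hstep : ∀ m k, k < P.K m → ∀ ω, φ (R.X m (k + 1) ω) ≠ ⊤ := by
    intro m k hk ω
    rw [hR.inner m k hk]
    exact hφ.prox_ne_top (hP.lamPlus_pos m) _
  have h0 : ∀ m ω, φ (R.X m 0 ω) ≠ ⊤ := by
    intro m ω
    cases m with
    | zero => rw [hR.init]; exact hP.x0_mem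
    | succ m =>
      -- As K_m ≥ 1, every later reference point is an output of the proximity operator.
      rw [hR.outer, ← Nat.sub_add_cancel (hP.K_pos m)]
      exact hstep m _ (Nat.sub_lt (hP.K_pos m) one_pos) ω
  intro k hk ω
  cases k with
  | zero => exact h0 m ω
  | succ k => exact hstep m k hk ω

end Run

/-! ### Descent over one outer loop -/

section Auxiliary

variable {E : Type*} [NormedAddCommGroup E] [InnerProductSpace ℝ E]

/-- Young's inequality with weight K - 1. For K = 1 the quotient K / (K - 1) is 0 by convention,
which is why p must vanish then. -/
lemma norm_add_sq_le_of_nat {K : ℕ} (p q : E) (h : p = 0 ∨ 2 ≤ K) (hK : 1 ≤ K) :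
    ‖p + q‖ ^ 2 ≤ (K : ℝ) / (K - 1) * ‖p‖ ^ 2 + K * ‖q‖ ^ 2 := by
  rcases h with rfl | h
  · have : (1 : ℝ) ≤ K := by exact_mod_cast hK
    simp only [zero_add, norm_zero]
    nlinarith [sq_nonneg ‖q‖]
  · obtain ⟨κ, hκ⟩ : ∃ κ : ℝ, κ = K - 1 := ⟨_, rfl⟩
    have hκ0 : 0 < κ := by
      have : (2 : ℝ) ≤ K := by exact_mod_cast h
      linarith
    have hK' : (K : ℝ) = κ + 1 := by linarith
    rw [← hκ, hK']
    have h1 : 0 ≤ κ⁻¹ * ‖p - κ • q‖ ^ 2 := by positivity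
    have h2 : κ⁻¹ * ‖p - κ • q‖ ^ 2
        = κ⁻¹ * ‖p‖ ^ 2 - 2 * inner ℝ p q + κ * ‖q‖ ^ 2 := by
      rw [norm_sub_sq_real, norm_smul, Real.norm_of_nonneg hκ0.le, real_inner_smul_right]
      field_simp
    have h3 : (κ + 1) / κ * ‖p‖ ^ 2 = ‖p‖ ^ 2 + κ⁻¹ * ‖p‖ ^ 2 := by field_simp
    rw [h3, norm_add_sq_real]
    linarith

lemma sum_range_cast_id (K : ℕ) : ∑ k ∈ Finset.range K, (k : ℝ) = K * (K - 1) / 2 := by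
  induction K with
  | zero => simp
  | succ K ih => rw [Finset.sum_range_succ, ih]; push_cast; ring

omit [InnerProductSpace ℝ E] in
lemma norm_sub_zero_le_sum (x : ℕ → E) (k : ℕ) :
    ‖x k - x 0‖ ≤ ∑ j ∈ Finset.range k, ‖x (j + 1) - x j‖ := by
  rw [← Finset.sum_range_sub]
  exact norm_sum_le _ _

omit [InnerProductSpace ℝ E] in
-- Cauchy–Schwarz on k telescoped increments gives a factor k, and these factors add up to K(K -
-- 1)/2. The K - 1 later cancels the denominator in `norm_add_sq_le_of_nat`.
lemma sum_norm_sub_zero_sq_le (x : ℕ → E) (K : ℕ) :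
    ∑ k ∈ Finset.range K, ‖x k - x 0‖ ^ 2
      ≤ (K : ℝ) * (K - 1) / 2 * ∑ j ∈ Finset.range K, ‖x (j + 1) - x j‖ ^ 2 := by
  rw [← sum_range_cast_id, Finset.sum_mul]
  refine Finset.sum_le_sum fun k hk => ?_
  have h1 := pow_le_pow_left₀ (norm_nonneg _) (norm_sub_zero_le_sum x k) 2
  have h2 := sq_sum_le_card_mul_sum_sq (s := Finset.range k) (f := fun j => ‖x (j + 1) - x j‖)
  rw [Finset.card_range] at h2
  refine h1.trans (h2.trans ?_)
  gcongr
  exact (Finset.mem_range.mp hk).le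

/-- The scalars stand for integrals: a of ‖F‖², dd of ‖D‖², e and vv of the squared errors of V_+
and V, xx and zz of the squared distances of X and Z to the reference point. The three summands of
the denominator in `hstep` match the three positive multiples of a: from ‖F‖², from ‖D‖², and from
the part of zz due to D. Together they use lam⁻¹ / 2 of the available 3/4 lam⁻¹ and leave 1/4. -/
lemma step_coefficients_le {lam lp α β ν Lf L ρ K b bp c a dd e vv xx zz : ℝ}
    (hlam : 0 < lam) (hlp : 0 < lp) (hρ0 : 0 ≤ ρ) (hK : 0 ≤ K) (hb : 0 < b) (hbp : 0 < bp)
    (ha : 0 ≤ a) (hc : xx ≤ c * xx) (hxx : 0 ≤ xx)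
    (hstep : lam ≤ (1 - ρ) * lp /
      (1 + ((α + Lf * β * lp) * ν) ^ 2 + (L * β * ν * lp) ^ 2 * K * bp⁻¹))
    (hdd : dd ≤ ν ^ 2 * a) (he : e ≤ L ^ 2 * bp⁻¹ * zz)
    (hzz : zz ≤ c * xx + K * (β ^ 2 * dd)) (hvv : vv ≤ L ^ 2 * b⁻¹ * xx) :
    (lp⁻¹ / 2 - 3 / 4 * lam⁻¹) * a + lp⁻¹ / 2 * (α + Lf * β * lp) ^ 2 * dd + lp / 2 * e
        + 3 / 4 * lam * vv
      ≤ -(lam⁻¹ / 4 * a) + 3 / 4 * lp * L ^ 2 * (bp⁻¹ + b⁻¹) * (c * xx) := by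
  set q := (L * β * ν * lp) ^ 2 * K * bp⁻¹ with hq
  set m := ((α + Lf * β * lp) * ν) ^ 2 with hm
  have hq0 : 0 ≤ q := by positivity
  have hm0 : 0 ≤ m := by positivity
  have hs : 0 < 1 + m + q := by positivity
  rw [le_div_iff₀ hs] at hstep
  have h1 : lam * (1 + m + q) ≤ lp := by nlinarith
  have h2 : lp⁻¹ * (1 + m + q) ≤ lam⁻¹ := by
    rw [inv_mul_le_iff₀ hlp, mul_comm, inv_mul_eq_div, le_div_iff₀ hlam]
    linarith
  have h3 : lam ≤ lp := by nlinarith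
  have h4 : lp⁻¹ / 2 * (α + Lf * β * lp) ^ 2 * dd ≤ lp⁻¹ / 2 * m * a := by
    calc lp⁻¹ / 2 * (α + Lf * β * lp) ^ 2 * dd
        ≤ lp⁻¹ / 2 * (α + Lf * β * lp) ^ 2 * (ν ^ 2 * a) := by gcongr
      _ = lp⁻¹ / 2 * m * a := by rw [hm]; ring
  have h5 : lp / 2 * e ≤ lp / 2 * L ^ 2 * bp⁻¹ * (c * xx) + lp⁻¹ / 2 * q * a := by
    calc lp / 2 * e ≤ lp / 2 * (L ^ 2 * bp⁻¹ * (c * xx + K * (β ^ 2 * (ν ^ 2 * a)))) := by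
          gcongr
          refine he.trans ?_
          gcongr
          refine hzz.trans ?_
          gcongr
      _ = _ := by rw [hq]; field_simp
  have hcx : 0 ≤ c * xx := hxx.trans hc
  have h6 : 3 / 4 * lam * vv ≤ 3 / 4 * lp * L ^ 2 * b⁻¹ * (c * xx) := by
    calc 3 / 4 * lam * vv ≤ 3 / 4 * lam * (L ^ 2 * b⁻¹ * (c * xx)) := by
          gcongr
          refine hvv.trans ?_
          gcongr
      _ ≤ 3 / 4 * lp * (L ^ 2 * b⁻¹ * (c * xx)) := by gcongr
      _ = _ := by ring
  have h7 : lp⁻¹ / 2 * (1 + m + q) * a ≤ lam⁻¹ / 2 * a := by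
    refine mul_le_mul_of_nonneg_right ?_ ha
    linarith
  have h8 : 0 ≤ lp * L ^ 2 * bp⁻¹ * (c * xx) := by positivity
  nlinarith

/-- Consequences of the step size bound `lp ≤ 1 / (2 Lf + T)`, where `T = L τ`. -/
lemma lamPlus_bounds {lp Lf T : ℝ} (hlp : 0 < lp) (hLf : 1 ≤ Lf) (hT : 0 ≤ T)
    (h : lp ≤ 1 / (2 * Lf + T)) :
    2 * Lf + T ≤ lp⁻¹ ∧ lp * T ^ 2 ≤ T ∧ lp ≤ 1 := by
  have h0 : 0 < 2 * Lf + T := by linarith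
  have h1 : lp * (2 * Lf + T) ≤ 1 := by rwa [le_div_iff₀ h0] at h
  refine ⟨?_, ?_, ?_⟩
  · rw [← one_div, le_div_iff₀ hlp]; linarith
  · have : lp * T ≤ 1 := by nlinarith
    nlinarith
  · nlinarith

end Auxiliary

/-- The standing assumptions on problem, method and step sizes. -/
structure VRSetup {n N : ℕ} {Ω : Type*} [MeasurableSpace Ω] (μ : Measure Ω)
    (f : Fin N → Eucl n → ℝ) (φ : Eucl n → EReal) (Lf L : ℝ≥0) (P : VRParams n)
    (R : VRProcess P N Ω) (nu : ℕ → ℕ → ℝ) (rhoBar : ℝ) : Prop where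
  N_pos : 0 < N
  convex : IsConvexLscProper φ
  diff : ∀ i, Differentiable ℝ (f i)
  lip : ∀ i, LipschitzWith L (gradient (f i))
  one_le_Lf : 1 ≤ Lf
  lipAvg : LipschitzWith Lf (gradient (avgFun f))
  bddBelow : AssumptionA2 f φ
  adm : P.Admissible φ
  samples : R.HasRandomSamples μ
  gen : R.IsGenerated f φ
  dirMeas : AssumptionC2 R
  dirBound : AssumptionC3 R μ f φ nu
  unbiased : AssumptionC4 R μ f
  rho_nonneg : 0 ≤ rhoBar
  steps : P.StepSizes Lf L nu rhoBar

/-! ### Moments and expected descent of one inner step -/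

namespace VRSetup

variable {n N : ℕ} {Ω : Type*} [mΩ : MeasurableSpace Ω] {μ : Measure Ω}
  [IsProbabilityMeasure μ]
  {f : Fin N → Eucl n → ℝ} {φ : Eucl n → EReal} {Lf L : ℝ≥0} {P : VRParams n}
  {R : VRProcess P N Ω} {nu : ℕ → ℕ → ℝ} {rhoBar : ℝ}

lemma integrable_X (H : VRSetup μ f φ Lf L P R nu rhoBar) {m k : ℕ} (hk : k ≤ P.K m)
    {E : Type*} [NormedAddCommGroup E] (G : Eucl n → E) :
    Integrable (fun ω => G (R.X m k ω)) μ :=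
  ((H.gen.finMeas_X H.dirMeas m k hk).comp G).integrable (H.samples.sigmaBefore_le m k)

/-- Everything computed from the data of one inner step is integrable. -/
lemma integrable_step (H : VRSetup μ f φ Lf L P R nu rhoBar) {m k : ℕ} (hk : k < P.K m)
    {E : Type*} [NormedAddCommGroup E] (G : Eucl n → Eucl n → Eucl n → Eucl n →
      (Fin (P.b m) → Fin N) → (Fin (P.bPlus m) → Fin N) → E) :
    Integrable (fun ω => G (R.X m k ω) (R.X m (k + 1) ω) (R.Xt m ω) (R.D m k ω)
      (R.S m k ω) (R.SPlus m k ω)) μ := by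
  have hX0 := (H.gen.finMeas_X H.dirMeas m 0 (Nat.zero_le _)).mono
    (R.sigmaBefore_le_of_le (Nat.zero_le (k + 1)))
  have hX := (H.gen.finMeas_X H.dirMeas m k hk.le).mono
    (R.sigmaBefore_le_of_le (Nat.le_succ k))
  have hX1 := H.gen.finMeas_X H.dirMeas m (k + 1) hk
  have hD := (H.dirMeas.finMeas_D hk).mono (R.sigmaUpTo_le_sigmaBefore hk)
  have hS := (R.finMeas_S m k).mono (R.sigmaUpTo_le_sigmaBefore hk)
  exact ((((hX.prodMk hX1).prodMk hX0).prodMk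
    ((hD.prodMk hS).prodMk (R.finMeas_SPlus hk))).comp fun p =>
      G p.1.1.1 p.1.1.2 p.1.2 p.2.1.1 p.2.1.2 p.2.2).integrable (H.samples.sigmaBefore_le m (k + 1))

/-- The residual `F` at `X_k^m` with the oracle `V_k^m`. -/
def _root_.VRProcess.resid (R : VRProcess P N Ω) (f : Fin N → Eucl n → ℝ) (φ : Eucl n → EReal)
    (m k : ℕ) (ω : Ω) : Eucl n :=
  proxResidual φ (P.lam m k) (R.V f m k ω) (R.X m k ω)

/-- (C.3) is conditional on the history before the outer loop only. This is why all estimates are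
integrated over events of `sigmaBefore m 0` rather than conditioned on the inner history. -/
lemma setIntegral_D_sq_le (H : VRSetup μ f φ Lf L P R nu rhoBar) {m k : ℕ} (hk : k < P.K m)
    {A : Set Ω} (hA : MeasurableSet[R.sigmaBefore m 0] A) :
    ∫ ω in A, ‖R.D m k ω‖ ^ 2 ∂μ ≤ nu m k ^ 2 * ∫ ω in A, ‖R.resid f φ m k ω‖ ^ 2 ∂μ := by
  have hle := H.samples.sigmaBefore_le m 0
  have h1 : Integrable (fun ω => ‖R.D m k ω‖ ^ 2) μ :=
    H.integrable_step hk fun _ _ _ d _ _ => ‖d‖ ^ 2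
  have h2 : Integrable (fun ω => ‖R.resid f φ m k ω‖ ^ 2) μ :=
    H.integrable_step hk fun x _ xt _ s _ =>
      ‖proxResidual φ (P.lam m k) (vrOracle f s x xt) x‖ ^ 2
  rw [← setIntegral_condExp hle h1 hA, ← setIntegral_condExp hle h2 hA, ← integral_const_mul]
  exact integral_mono_ae integrable_condExp.integrableOn
    (integrable_condExp.const_mul _).integrableOn (ae_restrict_of_ae (H.dirBound m k hk).2)

lemma setIntegral_V_sub_sq_le (H : VRSetup μ f φ Lf L P R nu rhoBar) {m k : ℕ} (hk : k < P.K m)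
    {A : Set Ω} (hA : MeasurableSet[R.sigmaBefore m 0] A) :
    ∫ ω in A, ‖R.V f m k ω - gradient (avgFun f) (R.X m k ω)‖ ^ 2 ∂μ
      ≤ (L : ℝ) ^ 2 * (P.b m : ℝ)⁻¹ * ∫ ω in A, ‖R.X m k ω - R.Xt m ω‖ ^ 2 ∂μ :=
  (H.samples.batch m k hk).setIntegral_norm_vrOracle_sub_sq_le (H.samples.sigmaBefore_le m k)
    H.N_pos (H.adm.b_pos m) H.diff H.lip (H.samples.meas m k hk)
    (H.gen.finMeas_X H.dirMeas m k hk.le)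
    ((H.gen.finMeas_X H.dirMeas m 0 (Nat.zero_le _)).mono
      (R.sigmaBefore_le_of_le (Nat.zero_le k)))
    (H.unbiased m k hk).1
    (H.integrable_step hk fun x _ xt _ s _ => ‖vrOracle f s x xt - gradient (avgFun f) x‖ ^ 2)
    (R.sigmaBefore_le_of_le (Nat.zero_le k) _ hA)

lemma setIntegral_VPlus_sub_sq_le (H : VRSetup μ f φ Lf L P R nu rhoBar) {m k : ℕ}
    (hk : k < P.K m) {A : Set Ω} (hA : MeasurableSet[R.sigmaBefore m 0] A) :
    ∫ ω in A, ‖R.VPlus f m k ω - gradient (avgFun f) (R.Z m k ω)‖ ^ 2 ∂μ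
      ≤ (L : ℝ) ^ 2 * (P.bPlus m : ℝ)⁻¹ * ∫ ω in A, ‖R.Z m k ω - R.Xt m ω‖ ^ 2 ∂μ := by
  have hle := R.sigmaBefore_le_sigmaUpTo m k
  refine (H.samples.batchPlus m k hk).setIntegral_norm_vrOracle_sub_sq_le
    (H.samples.sigmaUpTo_le hk) H.N_pos (H.adm.bPlus_pos m) H.diff H.lip
    (H.samples.measPlus m k hk)
    (((H.gen.finMeas_X H.dirMeas m k hk.le).mono hle).map₂ (H.dirMeas.finMeas_D hk)
      fun x d => x + P.beta m k • d)
    ((H.gen.finMeas_X H.dirMeas m 0 (Nat.zero_le _)).mono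
      ((R.sigmaBefore_le_of_le (Nat.zero_le k)).trans hle))
    (H.unbiased m k hk).2
    (H.integrable_step hk fun x _ xt d _ s =>
      ‖vrOracle f s (x + P.beta m k • d) xt - gradient (avgFun f) (x + P.beta m k • d)‖ ^ 2)
    ((R.sigmaBefore_le_of_le (Nat.zero_le k)).trans hle _ hA)

lemma setIntegral_inner_V_sub (H : VRSetup μ f φ Lf L P R nu rhoBar) {m k : ℕ} (hk : k < P.K m)
    {A : Set Ω} (hA : MeasurableSet[R.sigmaBefore m 0] A) (W : Eucl n → Eucl n) :
    ∫ ω in A, inner ℝ (W (R.X m k ω))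
      (R.V f m k ω - gradient (avgFun f) (R.X m k ω)) ∂μ = 0 := by
  have hX := H.gen.finMeas_X H.dirMeas m k hk.le
  exact setIntegral_inner_sub_eq_zero (H.samples.sigmaBefore_le m k) (hX.comp W) (hX.comp _)
    (H.integrable_step hk fun x _ xt _ s _ => vrOracle f s x xt)
    (H.integrable_step hk fun x _ xt _ s _ =>
      inner ℝ (W x) (vrOracle f s x xt - gradient (avgFun f) x))
    (H.unbiased m k hk).1 (R.sigmaBefore_le_of_le (Nat.zero_le k) _ hA)

lemma setIntegral_inner_VPlus_sub (H : VRSetup μ f φ Lf L P R nu rhoBar) {m k : ℕ}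
    (hk : k < P.K m) {A : Set Ω} (hA : MeasurableSet[R.sigmaBefore m 0] A)
    (W : Eucl n → Eucl n → Eucl n) :
    ∫ ω in A, inner ℝ (W (R.X m k ω) (R.D m k ω))
      (R.VPlus f m k ω - gradient (avgFun f) (R.Z m k ω)) ∂μ = 0 := by
  have hX := (H.gen.finMeas_X H.dirMeas m k hk.le).mono (R.sigmaBefore_le_sigmaUpTo m k)
  have hD := H.dirMeas.finMeas_D hk
  exact setIntegral_inner_sub_eq_zero (H.samples.sigmaUpTo_le hk) (hX.map₂ hD W)
    (hX.map₂ hD fun x d => gradient (avgFun f) (x + P.beta m k • d))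
    (H.integrable_step hk fun x _ xt d _ s => vrOracle f s (x + P.beta m k • d) xt)
    (H.integrable_step hk fun x _ xt d _ s => inner ℝ (W x d)
      (vrOracle f s (x + P.beta m k • d) xt - gradient (avgFun f) (x + P.beta m k • d)))
    (H.unbiased m k hk).2
    ((R.sigmaBefore_le_of_le (Nat.zero_le k)).trans (R.sigmaBefore_le_sigmaUpTo m k) _ hA)

omit [IsProbabilityMeasure μ] in
lemma lam_le_lamPlus (H : VRSetup μ f φ Lf L P R nu rhoBar) {m k : ℕ} (hk : k < P.K m) :
    P.lam m k ≤ P.lamPlus m := by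
  have h := H.steps.2 m k hk
  have hlp := H.adm.lamPlus_pos m
  have h1 : 1 ≤ 1 + P.muCoef Lf nu m k ^ 2 +
      (L * P.beta m k * nu m k * P.lamPlus m) ^ 2 * (P.K m : ℝ) * (P.bPlus m : ℝ)⁻¹ := by
    have : 0 ≤ P.muCoef Lf nu m k ^ 2 +
      (L * P.beta m k * nu m k * P.lamPlus m) ^ 2 * (P.K m : ℝ) * (P.bPlus m : ℝ)⁻¹ := by
      positivity
    linarith
  rw [le_div_iff₀ (by linarith)] at h
  have := H.rho_nonneg
  have hl := H.adm.lam_pos m k hk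
  nlinarith

/-- Expected descent of one inner step. -/
lemma setIntegral_psiReal_step_le (H : VRSetup μ f φ Lf L P R nu rhoBar) {m k : ℕ}
    (hk : k < P.K m) {A : Set Ω} (hA : MeasurableSet[R.sigmaBefore m 0] A) :
    ∫ ω in A, psiReal f φ (R.X m (k + 1) ω) ∂μ
      ≤ ∫ ω in A, psiReal f φ (R.X m k ω) ∂μ
        - ((P.lamPlus m)⁻¹ - Lf) / 2 * ∫ ω in A, ‖R.X m (k + 1) ω - R.X m k ω‖ ^ 2 ∂μ
        - (P.lam m k)⁻¹ / 4 * ∫ ω in A, ‖R.resid f φ m k ω‖ ^ 2 ∂μ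
        + 3 / 4 * P.lamPlus m * L ^ 2 * ((P.bPlus m : ℝ)⁻¹ + (P.b m : ℝ)⁻¹)
          * ((P.K m : ℝ) / (P.K m - 1) * ∫ ω in A, ‖R.X m k ω - R.Xt m ω‖ ^ 2 ∂μ) := by
  have hlam := H.adm.lam_pos m k hk
  have hlp := H.adm.lamPlus_pos m
  set g := gradient (avgFun f)
  set W : Eucl n → Eucl n → Eucl n := fun x d =>
    P.alpha m k • d + P.lamPlus m • (g x - g (x + P.beta m k • d)) with hW
  -- the pointwise estimate
  have hpt : ∀ ω, psiReal f φ (R.X m (k + 1) ω) ≤ psiReal f φ (R.X m k ω)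
      - ((P.lamPlus m)⁻¹ - Lf) / 2 * ‖R.X m (k + 1) ω - R.X m k ω‖ ^ 2
      + ((P.lamPlus m)⁻¹ / 2 - 3 / 4 * (P.lam m k)⁻¹) * ‖R.resid f φ m k ω‖ ^ 2
      + (P.lamPlus m)⁻¹ / 2 * (P.alpha m k + Lf * P.beta m k * P.lamPlus m) ^ 2
        * ‖R.D m k ω‖ ^ 2
      + P.lamPlus m / 2 * ‖R.VPlus f m k ω - g (R.Z m k ω)‖ ^ 2
      - inner ℝ (W (R.X m k ω) (R.D m k ω)) (R.VPlus f m k ω - g (R.Z m k ω))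
      + 3 / 4 * P.lam m k * ‖R.V f m k ω - g (R.X m k ω)‖ ^ 2
      + 1 / 2 * inner ℝ (proxResidual φ (P.lam m k) (g (R.X m k ω)) (R.X m k ω))
        (R.V f m k ω - g (R.X m k ω)) := fun ω =>
    psiReal_step_le H.convex H.diff H.lipAvg hlam hlp (H.adm.alpha_nonneg m k hk)
      (H.adm.beta_nonneg m k hk) (H.gen.X_ne_top H.convex H.adm m k hk.le ω)
      (R.D m k ω) (R.V f m k ω) (R.VPlus f m k ω) (R.Z m k ω) (R.X m (k + 1) ω)
      (g (R.X m k ω)) (g (R.Z m k ω)) (R.resid f φ m k ω) _ rfl (H.gen.inner m k hk ω) rfl rfl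
      rfl rfl
  have i0 : Integrable (fun ω => psiReal f φ (R.X m k ω)) (μ.restrict A) :=
    (H.integrable_X hk.le _).integrableOn
  have i1 : Integrable (fun ω => ‖R.X m (k + 1) ω - R.X m k ω‖ ^ 2) (μ.restrict A) :=
    (H.integrable_step hk fun x x1 _ _ _ _ => ‖x1 - x‖ ^ 2).integrableOn
  have i2 : Integrable (fun ω => ‖R.resid f φ m k ω‖ ^ 2) (μ.restrict A) :=
    (H.integrable_step hk fun x _ xt _ s _ =>
      ‖proxResidual φ (P.lam m k) (vrOracle f s x xt) x‖ ^ 2).integrableOn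
  have i3 : Integrable (fun ω => ‖R.D m k ω‖ ^ 2) (μ.restrict A) :=
    (H.integrable_step hk fun _ _ _ d _ _ => ‖d‖ ^ 2).integrableOn
  have i4 : Integrable (fun ω => ‖R.VPlus f m k ω - g (R.Z m k ω)‖ ^ 2) (μ.restrict A) :=
    (H.integrable_step hk fun x _ xt d _ s =>
      ‖vrOracle f s (x + P.beta m k • d) xt - g (x + P.beta m k • d)‖ ^ 2).integrableOn
  have i5 : Integrable (fun ω => inner ℝ (W (R.X m k ω) (R.D m k ω))
      (R.VPlus f m k ω - g (R.Z m k ω))) (μ.restrict A) :=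
    (H.integrable_step hk fun x _ xt d _ s => inner ℝ (W x d)
      (vrOracle f s (x + P.beta m k • d) xt - g (x + P.beta m k • d))).integrableOn
  have i6 : Integrable (fun ω => ‖R.V f m k ω - g (R.X m k ω)‖ ^ 2) (μ.restrict A) :=
    (H.integrable_step hk fun x _ xt _ s _ => ‖vrOracle f s x xt - g x‖ ^ 2).integrableOn
  have i7 : Integrable (fun ω => inner ℝ
      (proxResidual φ (P.lam m k) (g (R.X m k ω)) (R.X m k ω))
      (R.V f m k ω - g (R.X m k ω))) (μ.restrict A) :=
    (H.integrable_step hk fun x _ xt _ s _ => inner ℝ (proxResidual φ (P.lam m k) (g x) x)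
      (vrOracle f s x xt - g x)).integrableOn
  have j1 := i0.sub (i1.const_mul (((P.lamPlus m)⁻¹ - Lf) / 2))
  have j2 := j1.add (i2.const_mul ((P.lamPlus m)⁻¹ / 2 - 3 / 4 * (P.lam m k)⁻¹))
  have j3 := j2.add (i3.const_mul ((P.lamPlus m)⁻¹ / 2
    * (P.alpha m k + Lf * P.beta m k * P.lamPlus m) ^ 2))
  have j4 := j3.add (i4.const_mul (P.lamPlus m / 2))
  have j5 := j4.sub i5
  have j6 := j5.add (i6.const_mul (3 / 4 * P.lam m k))
  have j7 := j6.add (i7.const_mul (1 / 2))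
  have hint := integral_mono (H.integrable_X (m := m) (k := k + 1) hk
    (psiReal f φ)).integrableOn j7 hpt
  rw [integral_add' j6 (i7.const_mul _), integral_add' j5 (i6.const_mul _), integral_sub' j4 i5,
    integral_add' j3 (i4.const_mul _), integral_add' j2 (i3.const_mul _),
    integral_add' j1 (i2.const_mul _), integral_sub' i0 (i1.const_mul _)] at hint
  simp only [integral_const_mul] at hint
  have o1 := H.setIntegral_inner_V_sub hk hA fun x => proxResidual φ (P.lam m k) (g x) x
  have o2 := H.setIntegral_inner_VPlus_sub hk hA W
  rw [o1, o2] at hint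
  -- the distance of the trial point to the reference point
  have hcase : ∀ ω, R.X m k ω - R.Xt m ω = 0 ∨ 2 ≤ P.K m := by
    intro ω
    rcases Nat.eq_zero_or_pos k with rfl | h
    · exact Or.inl (sub_self _)
    · exact Or.inr (by omega)
  have i8 : Integrable (fun ω => ‖R.X m k ω - R.Xt m ω‖ ^ 2) (μ.restrict A) :=
    (H.integrable_step hk fun x _ xt _ _ _ => ‖x - xt‖ ^ 2).integrableOn
  have hz : ∫ ω in A, ‖R.Z m k ω - R.Xt m ω‖ ^ 2 ∂μ
      ≤ (P.K m : ℝ) / (P.K m - 1) * ∫ ω in A, ‖R.X m k ω - R.Xt m ω‖ ^ 2 ∂μ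
        + P.K m * (P.beta m k ^ 2 * ∫ ω in A, ‖R.D m k ω‖ ^ 2 ∂μ) := by
    rw [← integral_const_mul, ← integral_const_mul, ← integral_const_mul,
      ← integral_add (i8.const_mul _) ((i3.const_mul _).const_mul _)]
    refine integral_mono (H.integrable_step hk fun x _ xt d _ _ =>
      ‖x + P.beta m k • d - xt‖ ^ 2).integrableOn
      ((i8.const_mul _).add ((i3.const_mul _).const_mul _)) fun ω => ?_
    have := norm_add_sq_le_of_nat (R.X m k ω - R.Xt m ω) (P.beta m k • R.D m k ω) (hcase ω)
      (H.adm.K_pos m)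
    rw [norm_smul, mul_pow, Real.norm_eq_abs, sq_abs, sub_add_eq_add_sub] at this
    exact this
  have hxx0 : 0 ≤ ∫ ω in A, ‖R.X m k ω - R.Xt m ω‖ ^ 2 ∂μ :=
    integral_nonneg fun ω => by positivity
  -- For k = 0 both sides vanish, whatever K / (K - 1) is; k > 0 forces K ≥ 2.
  have hc : ∫ ω in A, ‖R.X m k ω - R.Xt m ω‖ ^ 2 ∂μ
      ≤ (P.K m : ℝ) / (P.K m - 1) * ∫ ω in A, ‖R.X m k ω - R.Xt m ω‖ ^ 2 ∂μ := by
    rcases Nat.eq_zero_or_pos k with rfl | h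
    · have : ∀ ω, ‖R.X m 0 ω - R.Xt m ω‖ ^ 2 = 0 := fun ω => by simp [VRProcess.Xt]
      simp [this]
    · have h2 : (2 : ℝ) ≤ P.K m := by exact_mod_cast (by omega : 2 ≤ P.K m)
      refine le_mul_of_one_le_left hxx0 ?_
      rw [le_div_iff₀ (by linarith)]
      linarith
  have hcoef := step_coefficients_le (α := P.alpha m k) (β := P.beta m k) (ν := nu m k) (Lf := Lf)
    (L := L) hlam hlp H.rho_nonneg (Nat.cast_nonneg (P.K m))
    (Nat.cast_pos.mpr (H.adm.b_pos m)) (Nat.cast_pos.mpr (H.adm.bPlus_pos m))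
    (integral_nonneg fun ω => by positivity) hc hxx0 (H.steps.2 m k hk)
    (H.setIntegral_D_sq_le hk hA) (H.setIntegral_VPlus_sub_sq_le hk hA) hz
    (H.setIntegral_V_sub_sq_le hk hA)
  linarith

end VRSetup

/-! ### Summation over an outer loop -/

namespace VRSetup

variable {n N : ℕ} {Ω : Type*} [mΩ : MeasurableSpace Ω] {μ : Measure Ω}
  [IsProbabilityMeasure μ]
  {f : Fin N → Eucl n → ℝ} {φ : Eucl n → EReal} {Lf L : ℝ≥0} {P : VRParams n}
  {R : VRProcess P N Ω} {nu : ℕ → ℕ → ℝ} {rhoBar : ℝ}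

/-- The integrated decrease of the objective over the `m`-th outer loop. -/
def _root_.VRProcess.decrease (R : VRProcess P N Ω) (μ : Measure Ω) (f : Fin N → Eucl n → ℝ)
    (φ : Eucl n → EReal) (m : ℕ) (A : Set Ω) : ℝ :=
  ∑ k ∈ Finset.range (P.K m), (P.lam m k)⁻¹ / 4 * ∫ ω in A, ‖R.resid f φ m k ω‖ ^ 2 ∂μ
    + (P.lamPlus m)⁻¹ / 8 * ∑ k ∈ Finset.range (P.K m),
      ∫ ω in A, ‖R.X m (k + 1) ω - R.X m k ω‖ ^ 2 ∂μ

lemma sum_setIntegral_sub_Xt_sq_le (H : VRSetup μ f φ Lf L P R nu rhoBar) (m : ℕ) (A : Set Ω) :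
    ∑ k ∈ Finset.range (P.K m), ∫ ω in A, ‖R.X m k ω - R.Xt m ω‖ ^ 2 ∂μ
      ≤ (P.K m : ℝ) * (P.K m - 1) / 2 * ∑ k ∈ Finset.range (P.K m),
        ∫ ω in A, ‖R.X m (k + 1) ω - R.X m k ω‖ ^ 2 ∂μ := by
  have i1 : ∀ k ∈ Finset.range (P.K m),
      Integrable (fun ω => ‖R.X m k ω - R.Xt m ω‖ ^ 2) (μ.restrict A) := fun k hk =>
    (H.integrable_step (Finset.mem_range.mp hk) fun x _ xt _ _ _ => ‖x - xt‖ ^ 2).integrableOn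
  have i2 : ∀ k ∈ Finset.range (P.K m),
      Integrable (fun ω => ‖R.X m (k + 1) ω - R.X m k ω‖ ^ 2) (μ.restrict A) := fun k hk =>
    (H.integrable_step (Finset.mem_range.mp hk) fun x x1 _ _ _ _ => ‖x1 - x‖ ^ 2).integrableOn
  rw [← integral_finsetSum _ i1, ← integral_finsetSum _ i2, ← integral_const_mul]
  exact integral_mono (integrable_finsetSum _ i1) ((integrable_finsetSum _ i2).const_mul _)
    fun ω => sum_norm_sub_zero_sq_le (fun k => R.X m k ω) (P.K m)

end VRSetup

lemma VRParams.mul_tau_sq {n : ℕ} (P : VRParams n) (L : ℝ) (m : ℕ) : (L * P.tau m) ^ 2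
    = L ^ 2 * ((P.bPlus m : ℝ)⁻¹ + (P.b m : ℝ)⁻¹) * (P.K m : ℝ) ^ 2 := by
  rw [VRParams.tau, mul_pow, mul_pow, Real.sq_sqrt (by positivity)]
  ring

namespace VRSetup

variable {n N : ℕ} {Ω : Type*} [mΩ : MeasurableSpace Ω] {μ : Measure Ω}
  {f : Fin N → Eucl n → ℝ} {φ : Eucl n → EReal} {Lf L : ℝ≥0} {P : VRParams n}
  {R : VRProcess P N Ω} {nu : ℕ → ℕ → ℝ} {rhoBar : ℝ}

lemma lamPlus_bounds (H : VRSetup μ f φ Lf L P R nu rhoBar) (m : ℕ) :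
    2 * (Lf : ℝ) + L * P.tau m ≤ (P.lamPlus m)⁻¹ ∧
      P.lamPlus m * (L * P.tau m) ^ 2 ≤ L * P.tau m ∧ P.lamPlus m ≤ 1 :=
  _root_.lamPlus_bounds (H.adm.lamPlus_pos m) (by exact_mod_cast H.one_le_Lf)
    (mul_nonneg L.2 (mul_nonneg (Nat.cast_nonneg _) (Real.sqrt_nonneg _))) (H.steps.1 m)

variable [IsProbabilityMeasure μ]

/-- Expected descent over one outer loop. -/
lemma setIntegral_psiReal_outer_le (H : VRSetup μ f φ Lf L P R nu rhoBar) (m : ℕ)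
    {A : Set Ω} (hA : MeasurableSet[R.sigmaBefore m 0] A) :
    ∫ ω in A, psiReal f φ (R.Xt (m + 1) ω) ∂μ + R.decrease μ f φ m A
      ≤ ∫ ω in A, psiReal f φ (R.Xt m ω) ∂μ := by
  obtain ⟨hl1, hl2, -⟩ := H.lamPlus_bounds m
  have hlp := H.adm.lamPlus_pos m
  have hlast : ∀ ω, R.Xt (m + 1) ω = R.X m (P.K m) ω := H.gen.outer m
  simp_rw [hlast]
  have hvar := H.sum_setIntegral_sub_Xt_sq_le m A
  have hsum := Finset.sum_le_sum fun k hk =>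
    H.setIntegral_psiReal_step_le (Finset.mem_range.mp hk) hA
  have htel := Finset.sum_range_sub (fun k => ∫ ω in A, psiReal f φ (R.X m k ω) ∂μ) (P.K m)
  rw [Finset.sum_sub_distrib] at htel
  change _ = _ - ∫ ω in A, psiReal f φ (R.Xt m ω) ∂μ at htel
  simp only [Finset.sum_sub_distrib, Finset.sum_add_distrib, ← Finset.mul_sum] at hsum
  unfold VRProcess.decrease
  set SD := ∑ k ∈ Finset.range (P.K m), ∫ ω in A, ‖R.X m (k + 1) ω - R.X m k ω‖ ^ 2 ∂μ
  set SX := ∑ k ∈ Finset.range (P.K m), ∫ ω in A, ‖R.X m k ω - R.Xt m ω‖ ^ 2 ∂μ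
  have hSD : 0 ≤ SD := Finset.sum_nonneg fun k _ => integral_nonneg fun ω => by positivity
  have hK : (1 : ℝ) ≤ P.K m := by exact_mod_cast H.adm.K_pos m
  -- For K ≥ 2 the factors K - 1 cancel; for K = 1 the left side is 0.
  have hcX : (P.K m : ℝ) / (P.K m - 1) * SX ≤ (P.K m : ℝ) ^ 2 / 2 * SD := by
    have h0 : 0 ≤ (P.K m : ℝ) / (P.K m - 1) := div_nonneg (by linarith) (by linarith)
    refine (mul_le_mul_of_nonneg_left hvar h0).trans ?_
    rw [← mul_assoc]
    refine mul_le_mul_of_nonneg_right ?_ hSD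
    rcases hK.eq_or_lt with h | h
    · rw [← h]; norm_num
    · have : (P.K m : ℝ) - 1 ≠ 0 := by linarith
      refine le_of_eq ?_
      field_simp
  set B := (P.bPlus m : ℝ)⁻¹ + (P.b m : ℝ)⁻¹ with hB
  have hB0 : 0 ≤ B := by positivity
  -- K² (1/b_+ + 1/b) = τ², and one factor Lτ is absorbed by λ_+ via `hl2`.
  have hT : 3 / 4 * P.lamPlus m * L ^ 2 * B * ((P.K m : ℝ) / (P.K m - 1) * SX)
      ≤ 3 / 8 * (L * P.tau m) * SD := by
    calc _ ≤ 3 / 4 * P.lamPlus m * L ^ 2 * B * ((P.K m : ℝ) ^ 2 / 2 * SD) := by gcongr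
      _ = 3 / 8 * (P.lamPlus m * (L * P.tau m) ^ 2) * SD := by
          rw [P.mul_tau_sq, ← hB]; ring
      _ ≤ _ := by gcongr
  -- After reserving λ_+⁻¹ / 8, there remains 3/8 λ_+⁻¹ - Lf/2, and λ_+⁻¹ ≥ 2 Lf + Lτ makes this at
  -- least 3/8 Lτ.
  have hfin : (P.lamPlus m)⁻¹ / 8 * SD + 3 / 8 * (L * P.tau m) * SD
      ≤ ((P.lamPlus m)⁻¹ - Lf) / 2 * SD := by
    rw [← add_mul]
    refine mul_le_mul_of_nonneg_right ?_ hSD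
    have : (0 : ℝ) ≤ Lf := Lf.2
    linarith
  linarith

/-- The exact residuals along one outer loop are controlled by the decrease. -/
lemma sum_integral_exactResidual_sq_le (H : VRSetup μ f φ Lf L P R nu rhoBar) (m : ℕ) :
    ∑ k ∈ Finset.range (P.K m), P.lam m k * ∫ ω, ‖exactResidual f φ (R.X m k ω)‖ ^ 2 ∂μ
      ≤ 8 * R.decrease μ f φ m Set.univ := by
  obtain ⟨hl1, hl2, hl3⟩ := H.lamPlus_bounds m
  have hlp := H.adm.lamPlus_pos m
  have hvar := H.sum_setIntegral_sub_Xt_sq_le m Set.univ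
  unfold VRProcess.decrease
  simp only [setIntegral_univ] at hvar ⊢
  set SD := ∑ k ∈ Finset.range (P.K m), ∫ ω, ‖R.X m (k + 1) ω - R.X m k ω‖ ^ 2 ∂μ
  have hSD : 0 ≤ SD := Finset.sum_nonneg fun k _ => integral_nonneg fun ω => by positivity
  have hstep : ∀ k ∈ Finset.range (P.K m),
      P.lam m k * ∫ ω, ‖exactResidual f φ (R.X m k ω)‖ ^ 2 ∂μ
        ≤ 8 * ((P.lam m k)⁻¹ / 4 * ∫ ω, ‖R.resid f φ m k ω‖ ^ 2 ∂μ)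
          + 2 * P.lamPlus m * L ^ 2 * (P.b m : ℝ)⁻¹
            * ∫ ω, ‖R.X m k ω - R.Xt m ω‖ ^ 2 ∂μ := by
    intro k hk'
    have hk := Finset.mem_range.mp hk'
    have hlam := H.adm.lam_pos m k hk
    have hll := H.lam_le_lamPlus hk
    have i1 : Integrable (fun ω => ‖R.resid f φ m k ω‖ ^ 2) μ :=
      H.integrable_step hk fun x _ xt _ s _ =>
        ‖proxResidual φ (P.lam m k) (vrOracle f s x xt) x‖ ^ 2
    have i2 : Integrable (fun ω => ‖R.V f m k ω - gradient (avgFun f) (R.X m k ω)‖ ^ 2) μ :=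
      H.integrable_step hk fun x _ xt _ s _ => ‖vrOracle f s x xt - gradient (avgFun f) x‖ ^ 2
    have h1 := integral_mono
      ((H.integrable_X hk.le fun x => ‖exactResidual f φ x‖ ^ 2).const_mul (P.lam m k))
      ((i1.const_mul (2 * (P.lam m k)⁻¹)).add (i2.const_mul (2 * P.lam m k)))
      fun ω => mul_norm_exactResidual_sq_le H.convex hlam (hll.trans hl3) (R.V f m k ω)
        (R.X m k ω)
    rw [integral_add' (i1.const_mul _) (i2.const_mul _)] at h1
    simp only [integral_const_mul] at h1
    have hvv := H.setIntegral_V_sub_sq_le hk MeasurableSet.univ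
    simp only [setIntegral_univ] at hvv
    have hx0 : 0 ≤ ∫ ω, ‖R.X m k ω - R.Xt m ω‖ ^ 2 ∂μ := integral_nonneg fun ω => by positivity
    have h2 : 2 * P.lam m k * ∫ ω, ‖R.V f m k ω - gradient (avgFun f) (R.X m k ω)‖ ^ 2 ∂μ
        ≤ 2 * P.lamPlus m * L ^ 2 * (P.b m : ℝ)⁻¹ * ∫ ω, ‖R.X m k ω - R.Xt m ω‖ ^ 2 ∂μ := by
      calc _ ≤ 2 * P.lamPlus m * (L ^ 2 * (P.b m : ℝ)⁻¹ *
            ∫ ω, ‖R.X m k ω - R.Xt m ω‖ ^ 2 ∂μ) := by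
            refine mul_le_mul (by linarith) hvv (integral_nonneg fun ω => by positivity)
              (by linarith)
        _ = _ := by ring
    linarith
  have hsum := Finset.sum_le_sum hstep
  rw [Finset.sum_add_distrib, ← Finset.mul_sum, ← Finset.mul_sum] at hsum
  have hK : (1 : ℝ) ≤ P.K m := by exact_mod_cast H.adm.K_pos m
  -- Chain: λ_+ (Lτ)² ≤ Lτ ≤ λ_+⁻¹. The result is 8 times the increment part of the decrease.
  have hlast : 2 * P.lamPlus m * L ^ 2 * (P.b m : ℝ)⁻¹ *
      ∑ k ∈ Finset.range (P.K m), ∫ ω, ‖R.X m k ω - R.Xt m ω‖ ^ 2 ∂μ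
      ≤ (P.lamPlus m)⁻¹ * SD := by
    have hbp : 0 ≤ (P.bPlus m : ℝ)⁻¹ := by positivity
    calc _ ≤ 2 * P.lamPlus m * L ^ 2 * ((P.bPlus m : ℝ)⁻¹ + (P.b m : ℝ)⁻¹) *
          ((P.K m : ℝ) ^ 2 / 2 * SD) := by
          gcongr
          · linarith
          · refine hvar.trans ?_
            gcongr
            nlinarith
      _ = P.lamPlus m * (L * P.tau m) ^ 2 * SD := by rw [P.mul_tau_sq]; ring
      _ ≤ (P.lamPlus m)⁻¹ * SD := by
          gcongr
          have : (0 : ℝ) ≤ Lf := Lf.2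
          linarith
  linarith

end VRSetup

/-! ### Convergence -/

/-- If `q` has summable increments and `∑ aₘ qₘ < ∞ = ∑ aₘ`, then `q` tends to zero. -/
lemma tendsto_zero_of_summable_weighted {q a : ℕ → ℝ} (hq : ∀ m, 0 ≤ q m) (ha : ∀ m, 0 ≤ a m)
    (hdiff : Summable fun m => |q (m + 1) - q m|) (haq : Summable fun m => a m * q m)
    (hdiv : Tendsto (fun M => ∑ m ∈ Finset.range M, a m) atTop atTop) :
    Tendsto q atTop (𝓝 0) := by
  have hcau : CauchySeq q := by
    refine cauchySeq_of_summable_dist ?_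
    refine hdiff.congr fun m => ?_
    rw [dist_comm, Real.dist_eq]
  obtain ⟨l, hl⟩ := cauchySeq_tendsto_of_complete hcau
  have hl0 : 0 ≤ l := ge_of_tendsto' hl hq
  rcases hl0.eq_or_lt with h | h
  · rwa [← h] at hl
  exfalso
  -- A positive limit l would give q ≥ l/2 eventually, so a would be summable along with a q.
  have hev : ∀ᶠ m in atTop, ‖a m‖ ≤ 2 / l * (a m * q m) := by
    filter_upwards [hl.eventually (lt_mem_nhds (half_lt_self h))] with m hm
    rw [Real.norm_of_nonneg (ha m)]
    have h1 : a m * (l / 2) ≤ a m * q m := mul_le_mul_of_nonneg_left hm.le (ha m)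
    calc a m = 2 / l * (a m * (l / 2)) := by field_simp
      _ ≤ _ := by gcongr
  have hsum : Summable a := (haq.mul_left (2 / l)).of_norm_bounded_eventually_nat hev
  exact not_tendsto_nhds_of_tendsto_atTop hdiv _ hsum.hasSum.tendsto_sum_nat

lemma tendsto_zero_of_sq {u : ℕ → ℝ} (h : Tendsto (fun m => u m ^ 2) atTop (𝓝 0)) :
    Tendsto u atTop (𝓝 0) := by
  have := h.sqrt
  simp only [Real.sqrt_sq_eq_abs, Real.sqrt_zero] at this
  exact (tendsto_zero_iff_abs_tendsto_zero _).mpr this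

lemma sq_integral_le_integral_sq {Ω : Type*} [MeasurableSpace Ω] {μ : Measure Ω}
    [IsProbabilityMeasure μ] {g : Ω → ℝ} (hg : Integrable g μ)
    (hg2 : Integrable (fun ω => g ω ^ 2) μ) : (∫ ω, g ω ∂μ) ^ 2 ≤ ∫ ω, g ω ^ 2 ∂μ := by
  set c := ∫ ω, g ω ∂μ with hc
  have h : 0 ≤ ∫ ω, (g ω - c) ^ 2 ∂μ := integral_nonneg fun ω => sq_nonneg _
  have e : ∀ ω, (g ω - c) ^ 2 = g ω ^ 2 - 2 * c * g ω + c ^ 2 := fun ω => by ring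
  simp_rw [e] at h
  have i : Integrable (fun ω => g ω ^ 2 - 2 * c * g ω) μ := hg2.sub (hg.const_mul _)
  rw [integral_add i (integrable_const _), integral_sub hg2 (hg.const_mul _), integral_const_mul, ← hc] at h
  simp at h
  nlinarith

/-- Pathwise bookkeeping for one outer loop: a is the weight K² / ∑ 1/λ, T + e the energy split into
residuals and increments, δ the path length, r and r' the residual norms at consecutive reference
points, s the average residual norm. -/
lemma energy_bounds_aux {rho kappa C a T e δ r r' s B : ℝ} (hrho : 0 < rho) (hkappa : 0 < kappa)
    (hC : 0 ≤ C) (ha : 0 < a) (haκ : a ≤ kappa) (hT : 0 ≤ T) (he : 0 ≤ e) (hδ : 0 ≤ δ)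
    (hr : 0 ≤ r) (hδκ : δ ^ 2 ≤ kappa * e) (hδρ : δ ^ 2 ≤ a * (rho⁻¹ * e))
    (hrr : |r' - r| ≤ C * δ) (hsr : |s - r| ≤ C * δ) (has : a * s ^ 2 ≤ T)
    (hB : B = (2 + 2 * kappa * (C ^ 2 * kappa)) * (1 + C) + C * rho⁻¹ + 2 * (C ^ 2 * kappa)) :
    a * r ^ 2 ≤ B * (T + e) ∧ |r' ^ 2 - r ^ 2| ≤ B * (T + e) ∧ (s - r) ^ 2 ≤ B * (T + e) := by
  obtain ⟨M, hM⟩ : ∃ M, M = C ^ 2 * kappa := ⟨_, rfl⟩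
  have hM0 : 0 ≤ M := by rw [hM]; positivity
  obtain ⟨B₁, hB₁⟩ : ∃ B₁, B₁ = 2 + 2 * kappa * M := ⟨_, rfl⟩
  have hB₁0 : 0 ≤ B₁ := by rw [hB₁]; positivity
  have hU : 0 ≤ T + e := by positivity
  have hCδ : C ^ 2 * δ ^ 2 ≤ M * e := by
    have := mul_le_mul_of_nonneg_left hδκ (sq_nonneg C)
    rw [hM]; linarith
  have hsr2 : (s - r) ^ 2 ≤ M * e := by
    have := sq_le_sq' (abs_le.mp hsr).1 (abs_le.mp hsr).2
    rw [mul_pow] at this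
    linarith
  have har : a * r ^ 2 ≤ B₁ * (T + e) := by
    have h3 : r ^ 2 ≤ 2 * s ^ 2 + 2 * (s - r) ^ 2 := by nlinarith [sq_nonneg (2 * s - r)]
    have h4 : a * (s - r) ^ 2 ≤ kappa * (M * e) :=
      mul_le_mul haκ hsr2 (sq_nonneg _) hkappa.le
    have h5 : a * r ^ 2 ≤ a * (2 * s ^ 2 + 2 * (s - r) ^ 2) :=
      mul_le_mul_of_nonneg_left h3 ha.le
    have h6 : 0 ≤ 2 * kappa * M * T := by positivity
    rw [hB₁]
    linarith
  have hdiff : |r' ^ 2 - r ^ 2| ≤ (C * (rho⁻¹ + B₁) + M) * (T + e) := by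
    have h3 : |r' ^ 2 - r ^ 2| ≤ C * (2 * (δ * r)) + C ^ 2 * δ ^ 2 := by
      have e1 : r' ^ 2 - r ^ 2 = (r' - r) * (r' - r) + (r' - r) * (2 * r) := by ring
      have hr2 : 0 ≤ 2 * r := by positivity
      rw [e1]
      refine (abs_add_le _ _).trans ?_
      rw [abs_mul, abs_mul, abs_of_nonneg hr2]
      have h5 : |r' - r| * |r' - r| ≤ C * δ * (C * δ) :=
        mul_le_mul hrr hrr (abs_nonneg _) (by positivity)
      have h6 : |r' - r| * (2 * r) ≤ C * δ * (2 * r) := mul_le_mul_of_nonneg_right hrr hr2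
      linarith
    -- Young's inequality with weight a: δ²/a is controlled by `hδρ`, and a r² by `har`, whereas r²
    -- alone has no bound by the energy.
    have h4 : 2 * (δ * r) ≤ rho⁻¹ * e + a * r ^ 2 := by
      have h5 : 0 ≤ (δ - a * r) ^ 2 := sq_nonneg _
      refine le_of_mul_le_mul_left ?_ ha
      linarith
    have h7 := mul_le_mul_of_nonneg_left (h4.trans (add_le_add_right har _)) hC
    have h9 : 0 ≤ (C * rho⁻¹ + M) * T := by positivity
    linarith
  have p1 : 0 ≤ B₁ * (T + e) := by positivity
  have p2 : 0 ≤ (C * (rho⁻¹ + B₁) + M) * (T + e) := by positivity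
  have p3 : 0 ≤ M * (T + e) := by positivity
  have p4 : 0 ≤ M * T := by positivity
  have hBe : B = B₁ + (C * (rho⁻¹ + B₁) + M) + M := by rw [hB, hB₁, hM]; ring
  rw [hBe]
  refine ⟨by linarith, by linarith, by linarith⟩

/-! ### Supermartingale convergence and summable energy -/

namespace VRSetup

variable {n N : ℕ} {Ω : Type*} [mΩ : MeasurableSpace Ω] {μ : Measure Ω}
  [IsProbabilityMeasure μ]
  {f : Fin N → Eucl n → ℝ} {φ : Eucl n → EReal} {Lf L : ℝ≥0} {P : VRParams n}
  {R : VRProcess P N Ω} {nu : ℕ → ℕ → ℝ} {rhoBar : ℝ}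

lemma integrable_Xt (H : VRSetup μ f φ Lf L P R nu rhoBar) (m : ℕ)
    {E : Type*} [NormedAddCommGroup E] (G : Eucl n → E) :
    Integrable (fun ω => G (R.Xt m ω)) μ :=
  H.integrable_X (Nat.zero_le _) G

omit [IsProbabilityMeasure μ] in
lemma decrease_nonneg (H : VRSetup μ f φ Lf L P R nu rhoBar) (m : ℕ) (A : Set Ω) :
    0 ≤ R.decrease μ f φ m A := by
  refine add_nonneg (Finset.sum_nonneg fun k hk => ?_) (mul_nonneg ?_ (Finset.sum_nonneg
    fun k _ => integral_nonneg fun ω => by positivity))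
  · have := H.adm.lam_pos m k (Finset.mem_range.mp hk)
    exact mul_nonneg (by positivity) (integral_nonneg fun ω => by positivity)
  · have := H.adm.lamPlus_pos m
    positivity

omit [IsProbabilityMeasure μ] in
lemma exists_le_psiReal (H : VRSetup μ f φ Lf L P R nu rhoBar) :
    ∃ c : ℝ, ∀ m ω, c ≤ psiReal f φ (R.Xt m ω) := by
  obtain ⟨c, hc⟩ := H.bddBelow
  refine ⟨c, fun m ω => ?_⟩
  have hx : φ (R.Xt m ω) ≠ ⊤ := H.gen.X_ne_top H.convex H.adm m 0 (Nat.zero_le _) ω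
  have := hc _ hx
  rw [H.convex.psi_eq_coe f hx] at this
  exact_mod_cast this

/-- The history before each outer loop. -/
def filtration (H : VRSetup μ f φ Lf L P R nu rhoBar) : Filtration ℕ mΩ where
  seq m := R.sigmaBefore m 0
  mono' := monotone_nat_of_le_succ fun m => R.sigmaBefore_le_succ m 0
  le' m := H.samples.sigmaBefore_le m 0

lemma supermartingale_psiReal (H : VRSetup μ f φ Lf L P R nu rhoBar) :
    Supermartingale (fun m ω => psiReal f φ (R.Xt m ω)) H.filtration μ := by
  refine supermartingale_of_setIntegral_succ_le (fun m => ?_) (fun m => H.integrable_Xt m _)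
    fun m A hA => ?_
  · exact ((H.gen.finMeas_X H.dirMeas m 0 (Nat.zero_le _)).comp (psiReal f φ)).stronglyMeasurable
  · have h1 := H.setIntegral_psiReal_outer_le m hA
    have h2 := H.decrease_nonneg m A
    linarith

lemma integral_psiReal_outer_le (H : VRSetup μ f φ Lf L P R nu rhoBar) (m : ℕ) :
    ∫ ω, psiReal f φ (R.Xt (m + 1) ω) ∂μ + R.decrease μ f φ m Set.univ
      ≤ ∫ ω, psiReal f φ (R.Xt m ω) ∂μ := by
  have := H.setIntegral_psiReal_outer_le m (A := Set.univ) MeasurableSet.univ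
  simpa only [setIntegral_univ] using this

lemma integral_psiReal_le (H : VRSetup μ f φ Lf L P R nu rhoBar) (m : ℕ) :
    ∫ ω, psiReal f φ (R.Xt m ω) ∂μ ≤ ∫ ω, psiReal f φ (R.Xt 0 ω) ∂μ := by
  induction m with
  | zero => exact le_rfl
  | succ m ih =>
    have h1 := H.integral_psiReal_outer_le m
    have h2 := H.decrease_nonneg m Set.univ
    linarith

/-- Almost sure convergence of the objective values. -/
lemma exists_tendsto_psi (H : VRSetup μ f φ Lf L P R nu rhoBar) :
    ∃ Y : Ω → ℝ, Measurable Y ∧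
      ∀ᵐ ω ∂μ, Tendsto (fun m => psi f φ (R.Xt m ω)) atTop (𝓝 (Y ω : EReal)) := by
  obtain ⟨c, hc⟩ := H.exists_le_psiReal
  set B := ∫ ω, psiReal f φ (R.Xt 0 ω) ∂μ + 2 * |c|
  -- The lower bound c gives |ψ| ≤ ψ + 2|c|, and E ψ(X̃^m) never exceeds its initial value. So the
  -- submartingale -ψ is bounded in L¹.
  have hbdd : ∀ m, eLpNorm ((-fun m ω => psiReal f φ (R.Xt m ω)) m) 1 μ ≤ (B.toNNReal : ℝ≥0) := by
    intro m
    have hi : Integrable (fun ω => psiReal f φ (R.Xt m ω)) μ := H.integrable_Xt m _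
    rw [Pi.neg_apply, eLpNorm_neg, eLpNorm_one_eq_lintegral_enorm,
      ← ofReal_integral_norm_eq_lintegral_enorm hi]
    refine ENNReal.ofReal_le_ofReal ?_
    have h1 : ∀ ω, ‖psiReal f φ (R.Xt m ω)‖ ≤ psiReal f φ (R.Xt m ω) + 2 * |c| := by
      intro ω
      have h2 := hc m ω
      have h3 := neg_abs_le c
      have h4 := abs_nonneg c
      rw [Real.norm_eq_abs, abs_le]
      constructor <;> linarith
    have h2 := integral_mono hi.norm (hi.add (integrable_const (2 * |c|))) h1
    rw [integral_add' hi (integrable_const _)] at h2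
    simp only [integral_const, probReal_univ, one_smul] at h2
    have := H.integral_psiReal_le m
    linarith
  obtain ⟨Y, hY, hlim⟩ := measurable_limit_of_tendsto_metrizable_ae
    (fun m => (H.integrable_Xt m (psiReal f φ)).aemeasurable) (L := atTop) (by
      filter_upwards [H.supermartingale_psiReal.neg.exists_ae_tendsto_of_bdd hbdd] with ω hω
      obtain ⟨l, hl⟩ := hω
      exact ⟨-l, by simpa using hl.neg⟩)
  refine ⟨Y, hY, ?_⟩
  filter_upwards [hlim] with ω hω
  refine ((continuous_coe_real_ereal.tendsto _).comp hω).congr fun m => ?_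
  exact (H.convex.psi_eq_coe f (H.gen.X_ne_top H.convex H.adm m 0 (Nat.zero_le _) ω)).symm

/-- Weighted squared residuals plus weighted squared increments of the `m`-th outer loop. -/
def _root_.VRProcess.energy (R : VRProcess P N Ω) (f : Fin N → Eucl n → ℝ) (φ : Eucl n → EReal)
    (m : ℕ) (ω : Ω) : ℝ :=
  ∑ k ∈ Finset.range (P.K m), P.lam m k * ‖exactResidual f φ (R.X m k ω)‖ ^ 2
    + (P.lamPlus m)⁻¹ * ∑ k ∈ Finset.range (P.K m), ‖R.X m (k + 1) ω - R.X m k ω‖ ^ 2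

/-- The average residual norm over the `m`-th outer loop. -/
def _root_.VRProcess.avgResidual (R : VRProcess P N Ω) (f : Fin N → Eucl n → ℝ)
    (φ : Eucl n → EReal) (m : ℕ) (ω : Ω) : ℝ :=
  (P.K m : ℝ)⁻¹ * ∑ k ∈ Finset.range (P.K m), ‖exactResidual f φ (R.X m k ω)‖

omit [IsProbabilityMeasure μ] in
lemma energy_nonneg (H : VRSetup μ f φ Lf L P R nu rhoBar) (m : ℕ) (ω : Ω) :
    0 ≤ R.energy f φ m ω := by
  have := H.adm.lamPlus_pos m
  exact add_nonneg (Finset.sum_nonneg fun k hk =>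
    mul_nonneg (H.adm.lam_pos m k (Finset.mem_range.mp hk)).le (by positivity)) (by positivity)

lemma integrable_energy (H : VRSetup μ f φ Lf L P R nu rhoBar) (m : ℕ) :
    Integrable (R.energy f φ m) μ := by
  refine Integrable.add (integrable_finsetSum _ fun k hk => ?_)
    ((integrable_finsetSum _ fun k hk => ?_).const_mul _)
  · exact H.integrable_X (Finset.mem_range.mp hk).le
      fun x => P.lam m k * ‖exactResidual f φ x‖ ^ 2
  · exact H.integrable_step (Finset.mem_range.mp hk) fun x x1 _ _ _ _ => ‖x1 - x‖ ^ 2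

lemma integral_energy_le (H : VRSetup μ f φ Lf L P R nu rhoBar) (m : ℕ) :
    ∫ ω, R.energy f φ m ω ∂μ ≤ 16 * R.decrease μ f φ m Set.univ := by
  have h1 := H.sum_integral_exactResidual_sq_le m
  have i1 : ∀ k ∈ Finset.range (P.K m),
      Integrable (fun ω => P.lam m k * ‖exactResidual f φ (R.X m k ω)‖ ^ 2) μ := fun k hk =>
    H.integrable_X (Finset.mem_range.mp hk).le fun x => P.lam m k * ‖exactResidual f φ x‖ ^ 2
  have i2 : ∀ k ∈ Finset.range (P.K m),
      Integrable (fun ω => ‖R.X m (k + 1) ω - R.X m k ω‖ ^ 2) μ := fun k hk =>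
    H.integrable_step (Finset.mem_range.mp hk) fun x x1 _ _ _ _ => ‖x1 - x‖ ^ 2
  unfold VRProcess.energy
  rw [integral_add (integrable_finsetSum _ i1) ((integrable_finsetSum _ i2).const_mul _),
    integral_const_mul, integral_finsetSum _ i1, integral_finsetSum _ i2]
  simp_rw [integral_const_mul]
  -- The term λ_+⁻¹ / 8 of the decrease accounts for a second factor 8, hence 16 in total.
  have h2 : (P.lamPlus m)⁻¹ * ∑ k ∈ Finset.range (P.K m),
      ∫ ω, ‖R.X m (k + 1) ω - R.X m k ω‖ ^ 2 ∂μ ≤ 8 * R.decrease μ f φ m Set.univ := by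
    have : 0 ≤ ∑ k ∈ Finset.range (P.K m),
        (P.lam m k)⁻¹ / 4 * ∫ ω, ‖R.resid f φ m k ω‖ ^ 2 ∂μ :=
      Finset.sum_nonneg fun k hk => by
        have := H.adm.lam_pos m k (Finset.mem_range.mp hk)
        exact mul_nonneg (by positivity) (integral_nonneg fun ω => by positivity)
    unfold VRProcess.decrease
    simp only [setIntegral_univ]
    linarith
  linarith

/-- The decreases telescope, and ψ is bounded below along the run. -/
lemma summable_integral_energy (H : VRSetup μ f φ Lf L P R nu rhoBar) :
    Summable fun m => ∫ ω, R.energy f φ m ω ∂μ := by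
  obtain ⟨c, hc⟩ := H.exists_le_psiReal
  refine summable_of_sum_range_le
    (c := 16 * (∫ ω, psiReal f φ (R.Xt 0 ω) ∂μ - c))
    (fun m => integral_nonneg (H.energy_nonneg m)) fun M => ?_
  have h1 : ∀ m ∈ Finset.range M, ∫ ω, R.energy f φ m ω ∂μ
      ≤ 16 * (∫ ω, psiReal f φ (R.Xt m ω) ∂μ - ∫ ω, psiReal f φ (R.Xt (m + 1) ω) ∂μ) := by
    intro m _
    have h2 := H.integral_energy_le m
    have h3 := H.integral_psiReal_outer_le m
    linarith
  refine (Finset.sum_le_sum h1).trans ?_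
  rw [← Finset.mul_sum, Finset.sum_range_sub']
  have h4 : c ≤ ∫ ω, psiReal f φ (R.Xt M ω) ∂μ := by
    have := integral_mono (integrable_const (μ := μ) c) (H.integrable_Xt M (psiReal f φ)) (hc M)
    simpa using this
  linarith

lemma ae_summable_energy (H : VRSetup μ f φ Lf L P R nu rhoBar) :
    ∀ᵐ ω ∂μ, Summable fun m => R.energy f φ m ω := by
  have h := summable_norm_of_tsum_eLpNorm_ne_top (μ := μ) (p := 1) le_rfl
    (f := fun m => R.energy f φ m) (fun m => (H.integrable_energy m).aestronglyMeasurable) (by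
      have : ∀ m, eLpNorm (R.energy f φ m) 1 μ = ENNReal.ofReal (∫ ω, R.energy f φ m ω ∂μ) := by
        intro m
        rw [eLpNorm_one_eq_lintegral_enorm,
          ← ofReal_integral_norm_eq_lintegral_enorm (H.integrable_energy m)]
        congr 2
        ext ω
        exact Real.norm_of_nonneg (H.energy_nonneg m ω)
      simp_rw [this]
      exact H.summable_integral_energy.tsum_ofReal_ne_top)
  filter_upwards [h] with ω hω
  exact hω.congr fun m => Real.norm_of_nonneg (H.energy_nonneg m ω)

omit [IsProbabilityMeasure μ] in
/-- Residual and averaged residual are controlled by the energy. -/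
lemma exists_energy_bounds (H : VRSetup μ f φ Lf L P R nu rhoBar) {rhoLow kappa : ℝ}
    (hrho : 0 < rhoLow) (hkappa : 0 < kappa)
    (h1 : ∀ m, rhoLow * P.lamPlus m ≤ (P.K m : ℝ) * (P.invLamSum m)⁻¹)
    (h2 : ∀ m, (P.K m : ℝ) * P.lamPlus m ≤ kappa) :
    ∃ B : ℝ, 0 ≤ B ∧ ∀ m ω,
      (P.K m : ℝ) ^ 2 * (P.invLamSum m)⁻¹ * ‖exactResidual f φ (R.Xt m ω)‖ ^ 2
        ≤ B * R.energy f φ m ω ∧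
      |‖exactResidual f φ (R.Xt (m + 1) ω)‖ ^ 2 - ‖exactResidual f φ (R.Xt m ω)‖ ^ 2|
        ≤ B * R.energy f φ m ω ∧
      (R.avgResidual f φ m ω - ‖exactResidual f φ (R.Xt m ω)‖) ^ 2
        ≤ B * R.energy f φ m ω := by
  obtain ⟨C, hC⟩ : ∃ C : ℝ, C = 2 + Lf := ⟨_, rfl⟩
  have hC0 : 0 ≤ C := by rw [hC]; positivity
  obtain ⟨B, hB⟩ : ∃ B : ℝ, B = (2 + 2 * kappa * (C ^ 2 * kappa)) * (1 + C)
    + C * rhoLow⁻¹ + 2 * (C ^ 2 * kappa) := ⟨_, rfl⟩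
  refine ⟨B, by rw [hB]; positivity, fun m ω => ?_⟩
  have hlp := H.adm.lamPlus_pos m
  have hK : (0 : ℝ) < P.K m := by exact_mod_cast H.adm.K_pos m
  have hlam : ∀ k ∈ Finset.range (P.K m), 0 < P.lam m k := fun k hk =>
    H.adm.lam_pos m k (Finset.mem_range.mp hk)
  -- the weights
  have hinv : (P.K m : ℝ) * (P.lamPlus m)⁻¹ ≤ P.invLamSum m := by
    unfold VRParams.invLamSum
    calc (P.K m : ℝ) * (P.lamPlus m)⁻¹ = ∑ _k ∈ Finset.range (P.K m), (P.lamPlus m)⁻¹ := by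
          simp
      _ ≤ _ := Finset.sum_le_sum fun k hk => by
          rw [one_div]
          exact inv_anti₀ (hlam k hk) (H.lam_le_lamPlus (Finset.mem_range.mp hk))
  have hinv0 : 0 < P.invLamSum m := lt_of_lt_of_le (by positivity) hinv
  obtain ⟨a, ha⟩ : ∃ a, a = (P.K m : ℝ) ^ 2 * (P.invLamSum m)⁻¹ := ⟨_, rfl⟩
  have ha0 : 0 < a := by rw [ha]; positivity
  -- From λ_k ≤ λ_+ one gets ∑ 1/λ_k ≥ K/λ_+, so a ≤ K λ_+.
  have haκ : a ≤ kappa := by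
    refine le_trans ?_ (h2 m)
    rw [ha, ← div_eq_mul_inv, div_le_iff₀ hinv0]
    calc (P.K m : ℝ) ^ 2 = P.K m * P.lamPlus m * (P.K m * (P.lamPlus m)⁻¹) := by field_simp
      _ ≤ _ := by gcongr
  have haρ : rhoLow * (P.K m * P.lamPlus m) ≤ a := by
    calc rhoLow * (P.K m * P.lamPlus m) = P.K m * (rhoLow * P.lamPlus m) := by ring
      _ ≤ P.K m * (P.K m * (P.invLamSum m)⁻¹) :=
          mul_le_mul_of_nonneg_left (h1 m) hK.le
      _ = a := by rw [ha]; ring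
  rw [← ha]
  -- residuals
  obtain ⟨T, hT⟩ : ∃ T, T = ∑ k ∈ Finset.range (P.K m),
    P.lam m k * ‖exactResidual f φ (R.X m k ω)‖ ^ 2 := ⟨_, rfl⟩
  obtain ⟨e, he⟩ : ∃ e, e = (P.lamPlus m)⁻¹ * ∑ k ∈ Finset.range (P.K m),
    ‖R.X m (k + 1) ω - R.X m k ω‖ ^ 2 := ⟨_, rfl⟩
  obtain ⟨δ, hδ⟩ : ∃ δ, δ = ∑ k ∈ Finset.range (P.K m), ‖R.X m (k + 1) ω - R.X m k ω‖ :=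
    ⟨_, rfl⟩
  have hU : R.energy f φ m ω = T + e := by rw [hT, he]; rfl
  have hT0 : 0 ≤ T := by
    rw [hT]
    exact Finset.sum_nonneg fun k hk => mul_nonneg (hlam k hk).le (by positivity)
  have he0 : 0 ≤ e := by rw [he]; positivity
  have hδ0 : 0 ≤ δ := by rw [hδ]; positivity
  obtain ⟨r, hr⟩ : ∃ r, r = ‖exactResidual f φ (R.Xt m ω)‖ := ⟨_, rfl⟩
  obtain ⟨r', hr'⟩ : ∃ r', r' = ‖exactResidual f φ (R.Xt (m + 1) ω)‖ := ⟨_, rfl⟩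
  obtain ⟨s, hs⟩ : ∃ s, s = R.avgResidual f φ m ω := ⟨_, rfl⟩
  have hr0 : 0 ≤ r := by rw [hr]; positivity
  have hδ2 : δ ^ 2 ≤ P.K m * P.lamPlus m * e := by
    have := sq_sum_le_card_mul_sum_sq (s := Finset.range (P.K m))
      (f := fun k => ‖R.X m (k + 1) ω - R.X m k ω‖)
    rw [Finset.card_range] at this
    rw [hδ, he]
    refine this.trans (le_of_eq ?_)
    field_simp
  have hδκ : δ ^ 2 ≤ kappa * e := hδ2.trans (mul_le_mul_of_nonneg_right (h2 m) he0)
  have hδρ : δ ^ 2 ≤ a * (rhoLow⁻¹ * e) := by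
    refine hδ2.trans ?_
    rw [← mul_assoc]
    refine mul_le_mul_of_nonneg_right ?_ he0
    rw [← div_eq_mul_inv, le_div_iff₀ hrho]
    linarith
  have hlip : ∀ k ≤ P.K m,
      |‖exactResidual f φ (R.X m k ω)‖ - ‖exactResidual f φ (R.Xt m ω)‖| ≤ C * δ := by
    intro k hk
    refine (abs_norm_sub_norm_le _ _).trans ?_
    refine (norm_exactResidual_sub_le H.convex H.lipAvg _ _).trans ?_
    rw [← hC]
    refine mul_le_mul_of_nonneg_left ?_ hC0
    refine (norm_sub_zero_le_sum (fun j => R.X m j ω) k).trans ?_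
    rw [hδ]
    exact Finset.sum_le_sum_of_subset_of_nonneg (Finset.range_mono hk) fun _ _ _ => norm_nonneg _
  have hrr : |r' - r| ≤ C * δ := by
    have := hlip (P.K m) le_rfl
    rw [← H.gen.outer m ω] at this
    rw [hr, hr']
    exact this
  have hsr : |s - r| ≤ C * δ := by
    have h3 : s - r = (P.K m : ℝ)⁻¹ * ∑ k ∈ Finset.range (P.K m),
        (‖exactResidual f φ (R.X m k ω)‖ - ‖exactResidual f φ (R.Xt m ω)‖) := by
      rw [hs, hr, VRProcess.avgResidual, Finset.sum_sub_distrib, Finset.sum_const,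
        Finset.card_range, nsmul_eq_mul, mul_sub, inv_mul_cancel_left₀ hK.ne']
    rw [h3, abs_mul, abs_of_pos (inv_pos.mpr hK), inv_mul_le_iff₀ hK]
    refine (Finset.abs_sum_le_sum_abs _ _).trans ?_
    refine (Finset.sum_le_sum fun k hk => hlip k (Finset.mem_range.mp hk).le).trans ?_
    simp
  -- Weighted Cauchy–Schwarz with weights 1/λ_k and λ_k; this is where the weight a comes from.
  have has : a * s ^ 2 ≤ T := by
    have hcs := Finset.sum_sq_le_sum_mul_sum_of_sq_le_mul (Finset.range (P.K m))
      (r := fun k => ‖exactResidual f φ (R.X m k ω)‖) (f := fun k => 1 / P.lam m k)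
      (g := fun k => P.lam m k * ‖exactResidual f φ (R.X m k ω)‖ ^ 2)
      (fun k hk => (one_div_pos.mpr (hlam k hk)).le)
      (fun k hk => mul_nonneg (hlam k hk).le (by positivity))
      (fun k hk => by
        have := (hlam k hk).ne'
        refine le_of_eq ?_
        field_simp)
    rw [← hT] at hcs
    change _ ≤ P.invLamSum m * T at hcs
    rw [ha, hs, VRProcess.avgResidual, mul_pow]
    calc (P.K m : ℝ) ^ 2 * (P.invLamSum m)⁻¹ * ((P.K m : ℝ)⁻¹ ^ 2 *
          (∑ k ∈ Finset.range (P.K m), ‖exactResidual f φ (R.X m k ω)‖) ^ 2)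
        = (P.invLamSum m)⁻¹ *
          (∑ k ∈ Finset.range (P.K m), ‖exactResidual f φ (R.X m k ω)‖) ^ 2 := by field_simp
      _ ≤ (P.invLamSum m)⁻¹ * (P.invLamSum m * T) := by gcongr
      _ = T := inv_mul_cancel_left₀ hinv0.ne' T
  rw [hU, ← hr, ← hr', ← hs]
  exact energy_bounds_aux hrho hkappa hC0 ha0 haκ hT0 he0 hδ0 hr0 hδκ hδρ hrr hsr has hB

end VRSetup

/-! ### Vanishing of the averaged residuals -/

namespace VRSetup

variable {n N : ℕ} {Ω : Type*} [mΩ : MeasurableSpace Ω] {μ : Measure Ω}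
  [IsProbabilityMeasure μ]
  {f : Fin N → Eucl n → ℝ} {φ : Eucl n → EReal} {Lf L : ℝ≥0} {P : VRParams n}
  {R : VRProcess P N Ω} {nu : ℕ → ℕ → ℝ} {rhoBar : ℝ}

omit [IsProbabilityMeasure μ] in
lemma weight_nonneg (H : VRSetup μ f φ Lf L P R nu rhoBar) (m : ℕ) :
    0 ≤ (P.K m : ℝ) ^ 2 * (P.invLamSum m)⁻¹ :=
  mul_nonneg (by positivity) (inv_nonneg.mpr (Finset.sum_nonneg fun k hk =>
    (one_div_pos.mpr (H.adm.lam_pos m k (Finset.mem_range.mp hk))).le))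

/-- Almost sure convergence of the averaged residuals. -/
lemma ae_tendsto_avgResidual (H : VRSetup μ f φ Lf L P R nu rhoBar) {rhoLow kappa : ℝ}
    (hrho : 0 < rhoLow) (hkappa : 0 < kappa)
    (hdiv : Tendsto (fun M => ∑ m ∈ Finset.range M, (P.K m : ℝ) ^ 2 * (P.invLamSum m)⁻¹)
      atTop atTop)
    (h1 : ∀ m, rhoLow * P.lamPlus m ≤ (P.K m : ℝ) * (P.invLamSum m)⁻¹)
    (h2 : ∀ m, (P.K m : ℝ) * P.lamPlus m ≤ kappa) :
    ∀ᵐ ω ∂μ, Tendsto (fun m => R.avgResidual f φ m ω) atTop (𝓝 0) := by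
  obtain ⟨B, -, hB⟩ := H.exists_energy_bounds hrho hkappa h1 h2
  filter_upwards [H.ae_summable_energy] with ω hω
  have hBs := hω.mul_left B
  -- The residual is first shown to vanish at the reference points; `hd` then carries this to the
  -- average.
  have hq := tendsto_zero_of_summable_weighted
    (q := fun m => ‖exactResidual f φ (R.Xt m ω)‖ ^ 2) (fun m => by positivity) H.weight_nonneg
    (hBs.of_nonneg_of_le (fun m => abs_nonneg _) fun m => (hB m ω).2.1)
    (hBs.of_nonneg_of_le (fun m => mul_nonneg (H.weight_nonneg m) (by positivity))
      fun m => (hB m ω).1) hdiv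
  have hd := squeeze_zero (fun m => sq_nonneg _) (fun m => (hB m ω).2.2)
    hBs.tendsto_atTop_zero
  simpa using (tendsto_zero_of_sq hd).add (tendsto_zero_of_sq hq)

lemma integrable_avgResidual (H : VRSetup μ f φ Lf L P R nu rhoBar) (m : ℕ) (G : ℝ → ℝ → ℝ) :
    Integrable (fun ω => G (R.avgResidual f φ m ω) ‖exactResidual f φ (R.Xt m ω)‖) μ := by
  have hle := H.samples.sigmaBefore_le (m + 1) 0
  have hX := fun k (hk : k < P.K m) => (H.gen.finMeas_X H.dirMeas m k hk.le).mono
    (R.sigmaBefore_le_succ m k)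
  have hsum : ∀ j ≤ P.K m, FinMeas (R.sigmaBefore (m + 1) 0)
      (fun ω => ∑ k ∈ Finset.range j, ‖exactResidual f φ (R.X m k ω)‖) := by
    intro j
    induction j with
    | zero => exact fun _ => FinMeas.const 0
    | succ j ih =>
      intro hj
      simp_rw [Finset.sum_range_succ]
      exact (ih (Nat.le_of_succ_le hj)).map₂ (hX j hj) fun a x => a + ‖exactResidual f φ x‖
  exact ((hsum _ le_rfl).map₂ (hX 0 (H.adm.K_pos m)) fun a x =>
    G ((P.K m : ℝ)⁻¹ * a) ‖exactResidual f φ x‖).integrable hle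

/-- Convergence in mean of the averaged residuals. -/
lemma tendsto_integral_avgResidual (H : VRSetup μ f φ Lf L P R nu rhoBar) {rhoLow kappa : ℝ}
    (hrho : 0 < rhoLow) (hkappa : 0 < kappa)
    (hdiv : Tendsto (fun M => ∑ m ∈ Finset.range M, (P.K m : ℝ) ^ 2 * (P.invLamSum m)⁻¹)
      atTop atTop)
    (h1 : ∀ m, rhoLow * P.lamPlus m ≤ (P.K m : ℝ) * (P.invLamSum m)⁻¹)
    (h2 : ∀ m, (P.K m : ℝ) * P.lamPlus m ≤ kappa) :
    Tendsto (fun m => ∫ ω, R.avgResidual f φ m ω ∂μ) atTop (𝓝 0) := by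
  obtain ⟨B, -, hB⟩ := H.exists_energy_bounds hrho hkappa h1 h2
  have hBs := H.summable_integral_energy.mul_left B
  have iU := fun m => (H.integrable_energy m).const_mul B
  have iq : ∀ m, Integrable (fun ω => ‖exactResidual f φ (R.Xt m ω)‖ ^ 2) μ := fun m =>
    H.integrable_Xt m fun x => ‖exactResidual f φ x‖ ^ 2
  have hq := tendsto_zero_of_summable_weighted
    (q := fun m => ∫ ω, ‖exactResidual f φ (R.Xt m ω)‖ ^ 2 ∂μ)
    (fun m => integral_nonneg fun ω => by positivity) H.weight_nonneg
    (hBs.of_nonneg_of_le (fun m => abs_nonneg _) fun m => by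
      rw [← integral_sub (iq (m + 1)) (iq m), ← integral_const_mul]
      exact abs_integral_le_integral_abs.trans (integral_mono ((iq (m + 1)).sub (iq m)).abs
        (iU m) fun ω => (hB m ω).2.1))
    (hBs.of_nonneg_of_le (fun m => mul_nonneg (H.weight_nonneg m)
      (integral_nonneg fun ω => by positivity)) fun m => by
      rw [← integral_const_mul, ← integral_const_mul]
      exact integral_mono ((iq m).const_mul _) (iU m) fun ω => (hB m ω).1) hdiv
  have ht := (hq.const_mul 2).add (hBs.tendsto_atTop_zero.const_mul 2)
  simp only [mul_zero, add_zero] at ht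
  -- Jensen: (E s)² ≤ E s² ≤ 2 E r² + 2 E (s - r)², with both terms tending to zero.
  refine tendsto_zero_of_sq (squeeze_zero (fun m => sq_nonneg _) (fun m => ?_) ht)
  have is2 : Integrable (fun ω => R.avgResidual f φ m ω ^ 2) μ :=
    H.integrable_avgResidual m fun a _ => a ^ 2
  refine (sq_integral_le_integral_sq (H.integrable_avgResidual m fun a _ => a) is2).trans ?_
  rw [← integral_const_mul, ← integral_const_mul, ← integral_const_mul,
    ← integral_add ((iq m).const_mul 2) ((iU m).const_mul 2)]
  refine integral_mono is2 (((iq m).const_mul 2).add ((iU m).const_mul 2)) fun ω => ?_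
  have h3 := (hB m ω).2.2
  have h4 := add_sq_le (a := ‖exactResidual f φ (R.Xt m ω)‖)
    (b := R.avgResidual f φ m ω - ‖exactResidual f φ (R.Xt m ω)‖)
  rw [add_sub_cancel] at h4
  change _ ≤ 2 * ‖exactResidual f φ (R.Xt m ω)‖ ^ 2 + 2 * (B * R.energy f φ m ω)
  linarith

end VRSetup

end

theorem mainTheorem4 {n N : ℕ} (hN : 0 < N)
    {Ω : Type*} [MeasurableSpace Ω] (μ : Measure Ω) [IsProbabilityMeasure μ]
    (f : Fin N → Eucl n → ℝ) (φ : Eucl n → EReal) (hφ : IsConvexLscProper φ)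
    (Lf : ℝ≥0) (Li : Fin N → ℝ≥0) (L : ℝ≥0) (hL : L = Finset.univ.sup Li)
    (P : VRParams n) (hP : P.Admissible φ)
    (R : VRProcess P N Ω) (hS : R.HasRandomSamples μ) (hR : R.IsGenerated f φ)
    (nu : ℕ → ℕ → ℝ)
    (hA1 : AssumptionA1 f Lf) (hA2 : AssumptionA2 f φ)
    (hC1 : AssumptionC1 f Li) (hC2 : AssumptionC2 R) (hC3 : AssumptionC3 R μ f φ nu)
    (hC4 : AssumptionC4 R μ f)
    (rhoBar : ℝ) (hrho0 : 0 ≤ rhoBar) (hrho1 : rhoBar < 1)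
    (hstep : P.StepSizes Lf L nu rhoBar) :
    (∃ Y : Ω → ℝ, Measurable Y ∧
      ∀ᵐ ω ∂μ, Tendsto (fun m => psi f φ (R.Xt m ω)) atTop (𝓝 (Y ω : EReal))) ∧
    (∀ rhoLow kappa : ℝ, 0 < rhoLow → 0 < kappa →
      Tendsto (fun M => ∑ m ∈ Finset.range M, (P.K m : ℝ) ^ 2 * (P.invLamSum m)⁻¹)
        atTop atTop →
      (∀ m, rhoLow * P.lamPlus m ≤ (P.K m : ℝ) * (P.invLamSum m)⁻¹) →
      (∀ m, (P.K m : ℝ) * P.lamPlus m ≤ kappa) →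
      (∀ᵐ ω ∂μ, Tendsto
        (fun m => (P.K m : ℝ)⁻¹ *
          ∑ k ∈ Finset.range (P.K m), ‖exactResidual f φ (R.X m k ω)‖) atTop (𝓝 0)) ∧
      (∀ m k, k < P.K m → Integrable (fun ω => ‖exactResidual f φ (R.X m k ω)‖) μ) ∧
      Tendsto
        (fun m => (P.K m : ℝ)⁻¹ *
          ∑ k ∈ Finset.range (P.K m), ∫ ω, ‖exactResidual f φ (R.X m k ω)‖ ∂μ)
        atTop (𝓝 0)) := by
  have H : VRSetup μ f φ Lf L P R nu rhoBar :=
    { N_pos := hN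
      convex := hφ
      diff := fun i => (hC1 i).1
      lip := fun i => (hC1 i).2.weaken (hL ▸ Finset.le_sup (Finset.mem_univ i))
      one_le_Lf := hA1.1
      lipAvg := hA1.2
      bddBelow := hA2
      adm := hP
      samples := hS
      gen := hR
      dirMeas := hC2
      dirBound := hC3
      unbiased := hC4
      rho_nonneg := hrho0
      steps := hstep }
  refine ⟨H.exists_tendsto_psi, fun rhoLow kappa hrho hkappa hdiv h1 h2 =>
    ⟨H.ae_tendsto_avgResidual hrho hkappa hdiv h1 h2,
      fun m k hk => H.integrable_X hk.le fun x => ‖exactResidual f φ x‖, ?_⟩⟩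
  refine (H.tendsto_integral_avgResidual hrho hkappa hdiv h1 h2).congr fun m => ?_
  unfold VRProcess.avgResidual
  rw [integral_const_mul, integral_finsetSum _ fun k hk =>
    H.integrable_X (Finset.mem_range.mp hk).le fun x => ‖exactResidual f φ x‖]
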